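/- **Setting.** Norms are Euclidean (induced, for matrices). For $g:\mathbb{R}^m\to\mathbb{R}$, $x\in\mathbb{R}^m$ and $D=[d_1\cdots d_z]\in\mathbb{R}^{m\times z}$ put $\delta_g(x;D)=(g(x+d_i)-g(x))_{i=1}^z$, $\nabla_S g(x;D)=(D^\top)^\dagger\delta_g(x;D)$ ($\dagger$ is the Moore–Penrose pseudoinverse), and $\nabla_S^2 g(x;D)=(D^\top)^\dagger\Delta$, where the $i$-th row of $\Delta\in\mathbb{R}^{z\times m}$ is $(\nabla_S g(x+d_i;D)-\nabla_S g(x;D))^\top$. *Algorithm QARSTA.* Input: $f:\mathbb{R}^n\to\mathbb{R}$, integers $1\le p_{\rm rand}\le p\le n$, $x_0\in\mathbb{R}^n$, $0<\Delta_{\min}\le\Delta_0\le\Delta_{\max}$, $0<\gamma_{\rm dec}<1<\gamma_{\rm inc}$, $0<\eta_1\le\eta_2<1$, $\mu>0$, $\epsilon_{\rm rad}\ge1$, $\epsilon_{\rm geo}>0$, $M_A\ge1$. Initially $D_0\in\mathbb{R}^{n\times p}$ has generated columns (see below) of length $\Delta_0$, with no recycled directions. In iteration $k=0,1,\dots$ one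 factorizes $D_k=Q_kR_k$ (QR) and sets, with $\hat f(\hat s)=f(x_k+Q_k\hat s)$, $$\hat m_k(\hat s)=\hat f(0)+\big(2\nabla_S\hat f(0;R_k)-\nabla_S\hat f(0;2R_k)\big)^\top\hat s+\tfrac12\hat s^\top\nabla_S^2\hat f(0;R_k)\hat s .$$ If $\mu\|\nabla\hat m_k(0)\|<\Delta_k$ (iteration $k$ is critical), then $\Delta_{k+1}=\gamma_{\rm dec}\Delta_k$, $x_{k+1}=x_k$, $D_{k+1}=\gamma_{\rm dec}D_k$. Otherwise a step $\hat s_k$ with $\|\hat s_k\|\le\Delta_k$ is computed and, with $s_k=Q_k\hat s_k$ and $\rho_k=\frac{f(x_k)-f(x_k+s_k)}{\hat m_k(0)-\hat m_k(\hat s_k)}$, one sets $\Delta_{k+1}=\gamma_{\rm dec}\Delta_k$ if $\rho_k<\eta_1$, $\Delta_{k+1}=\min(\gamma_{\rm inc}\Delta_k,\Delta_{\max})$ if $\rho_k>\eta_2$ and $\|\hat s_k\|\ge0.95\Delta_k$, and $\Delta_{k+1}=\Delta_k$ in the remaining cases; $x_{k+1}$ is any point with $f(x_{k+1})\le f(x_k+s_k)$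 and $f(x_{k+1})\le f(x_k+u+v)$ for all $u,v$ that are $0$ or columns of $D_k$; and $D_{k+1}=[D^U_{k+1}\;D^R_{k+1}]$ is built as follows. - Recycled directions $D^U_{k+1}$: choose $p$ vectors, each of the form $x_k+s_k-x_{k+1}$ or $x_k+u+v-x_{k+1}$ with $u,v$ as above; remove $p_{\rm rand}$ of them, one at a time, each time one with the largest $\theta_i=\sigma_{\min}(M_i)\max(\|d_i\|^4/\Delta_{k+1}^4,1)$, where $M_i$ is the current matrix without its column $d_i$; then remove all $d$ with $\|d\|>\epsilon_{\rm rad}\Delta_{k+1}$; then, while the matrix is nonempty with $\sigma_{\min}<\epsilon_{\rm geo}$, remove one more direction by the same rule. - Generated directions $D^R_{k+1}$: if $p_1$ directions were recycled, put $q=p-p_1$; sample $A\in\mathbb{R}^{n\times q}$ with independent $N(0,1/q)$ entries conditioned on $A$ having full column rank and $\|A\|\le M_A$, given everything that happened before; let $\tilde A=A-BB^\top A$ with $B$ an orthonormal basis of the span of the recycled directions, $\tilde A=\tilde Q\tilde R$ (QR), and take the columns of $\Delta_{k+1}\tilde Q$, which are mutually orthogonal, of length $\Delta_{k+1}$, and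 orthogonal to the recycled directions. The algorithm stops at the end of iteration $k$ if $\Delta_{k+1}<\Delta_{\min}$; let $\tau$ be the index of that iteration ($\infty$ if there is none). The history before the sampling for $D_k$ is a σ-algebra $\mathcal F_k$ of a filtration that contains $x_k$, $\Delta_k$, the recycled directions of $D_k$, and everything computed in earlier iterations. **Assumptions.** (1) $f\in C^2$ and $\nabla^2f$ is Lipschitz with constant $L$. (2) $f\ge f_{\rm low}$. (3) $\|\nabla^2\hat m_k\|\le\kappa_H$ in all performed iterations, $\kappa_H\ge1$. (4) In all performed non-critical iterations, $\hat m_k(0)-\hat m_k(\hat s_k)\ge c_1\|\nabla\hat m_k(0)\|\min\big(\Delta_k,\|\nabla\hat m_k(0)\|/\max\{\|\nabla^2\hat m_k\|,1\}\big)$, with $c_1\in(0,1/2]$. (5) There are $\alpha_D>0$ and $\delta_S>0$ such that, for every performed iteration $k$ whose $D_k$ was built with newly generated directions (i.e. $k=0$ or iteration $k-1$ was not critical), $\mathbb P\big[\|D_k^\top\nabla f(x_k)\|\ge\alpha_D\|\nabla f(x_k)\|\;\big|\;\mathcal F_k\big]\ge1-\delta_S$ almost surely. **Constants.** Let $C_1=\frac{\ln\gamma_{\rm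 inc}}{\ln(1/\gamma_{\rm dec})}$, $C_2=\frac{\ln(\Delta_0/\Delta_{\min})}{\ln(1/\gamma_{\rm dec})}$, $C_3=\frac{(1-\delta_S-C_1/(C_1+1))^2}{8(1-\delta_S)}$, $M=\max\{1/\epsilon_{\rm geo},1/\Delta_{\min}\}\,\epsilon_{\rm rad}\Delta_{\max}$, $\kappa_{eg}=3\sqrt p\,L\,M(2pM^2+1)\epsilon_{\rm rad}^2$, $\kappa=\kappa_{eg}\max\big\{1,\tfrac{\Delta_{\max}}{3(2pM^2+1)}\big\}$ (so $\kappa=\kappa_{eg}$ unless $\Delta_{\max}>3(2pM^2+1)$; in particular $\kappa=\kappa_{eg}$ if $\Delta_{\min}\le6$), $M_D=\epsilon_{\rm rad}\Delta_{\max}\sqrt p+\Delta_{\max}$, and for $\epsilon>0$ $$\epsilon_g(\epsilon)=\frac{\alpha_D\epsilon}{(\kappa\mu+1)M_D},\quad \phi(\epsilon)=\frac{f(x_0)-f_{\rm low}}{\eta_1c_1\epsilon_g(\epsilon)\min(\epsilon_g(\epsilon)/\kappa_H,\Delta_{\min})},\quad \psi(\epsilon)=\phi(\epsilon)+\frac{C_2}{C_1+1},\quad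 K_{\min}(\epsilon)=\frac{2\psi(\epsilon)}{1-\delta_S-C_1/(C_1+1)}-1 .$$ **Theorem.** Suppose (1)–(5) hold and $0<\delta_S<1/(C_1+1)$. For $\epsilon>0$ let $K_\epsilon=\min\{k:\|\nabla f(x_k)\|\le\epsilon\}$ ($\infty$ if there is no such $k$) and $$B(\epsilon)=K_{\min}(\epsilon)+\frac{e^{-C_3(K_{\min}(\epsilon)+1)}}{1-e^{-C_3}} .$$ Then, for every $\epsilon>0$, $\mathbb E[\min(K_\epsilon,\tau)]\le B(\epsilon)$; in particular, $\mathbb E[K_\epsilon]\le B(\epsilon)$ whenever the stopping test almost surely does not succeed in any iteration before $K_\epsilon$ (that is, $K_\epsilon\le\tau$ a.s.). Moreover, $B(\epsilon)=O(\epsilon^{-2})$ as $\epsilon\downarrow0$. -/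

import Mathlib

open MeasureTheory ProbabilityTheory Filter Topology
open scoped NNReal ENNReal Matrix

noncomputable section

namespace QARSTA

/-- `ℝⁿ` with the Euclidean inner product and norm. -/
abbrev E (n : ℕ) : Type := EuclideanSpace ℝ (Fin n)

/-! ### Linear algebra -/

/-- The matrix-vector product between Euclidean spaces. -/
def app {m n : ℕ} (A : Matrix (Fin m) (Fin n) ℝ) (v : E n) : E m := Matrix.toEuclideanLin A v

/-- The `j`-th column of a matrix as a Euclidean vector. -/
def col {m n : ℕ} (A : Matrix (Fin m) (Fin n) ℝ) (j : Fin n) : E m :=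
  WithLp.toLp 2 (fun i => A i j)

/-- The list of columns of a matrix. -/
def cols {m n : ℕ} (A : Matrix (Fin m) (Fin n) ℝ) : List (E m) := List.ofFn (col A)

/-- The matrix norm induced by the Euclidean vector norms. -/
def opNorm {m n : ℕ} (A : Matrix (Fin m) (Fin n) ℝ) : ℝ :=
  ‖LinearMap.toContinuousLinearMap (Matrix.toEuclideanLin A)‖

/-- The four Penrose conditions: `B` is a Moore-Penrose pseudoinverse of `A`. -/
def IsPinv {m n : ℕ} (A : Matrix (Fin m) (Fin n) ℝ) (B : Matrix (Fin n) (Fin m) ℝ) : Prop :=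
  A * B * A = A ∧ B * A * B = B ∧ (A * B)ᵀ = A * B ∧ (B * A)ᵀ = B * A

theorem IsPinv.unique {m n : ℕ} {A : Matrix (Fin m) (Fin n) ℝ} {B C : Matrix (Fin n) (Fin m) ℝ}
    (hB : IsPinv A B) (hC : IsPinv A C) : B = C := by
  obtain ⟨b1, b2, b3, b4⟩ := hB
  obtain ⟨c1, c2, c3, c4⟩ := hC
  have h1 : A * B = A * C := by
    calc A * B = (A * B)ᵀ := b3.symm
      _ = ((A * C) * (A * B))ᵀ := by rw [← Matrix.mul_assoc, c1]
      _ = (A * B)ᵀ * (A * C)ᵀ := Matrix.transpose_mul _ _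
      _ = (A * B) * (A * C) := by rw [b3, c3]
      _ = A * C := by rw [← Matrix.mul_assoc, b1]
  have h2 : B * A = C * A := by
    calc B * A = (B * A)ᵀ := b4.symm
      _ = ((B * A) * (C * A))ᵀ := by rw [Matrix.mul_assoc, ← Matrix.mul_assoc A C A, c1]
      _ = (C * A)ᵀ * (B * A)ᵀ := Matrix.transpose_mul _ _
      _ = (C * A) * (B * A) := by rw [b4, c4]
      _ = C * A := by rw [Matrix.mul_assoc, ← Matrix.mul_assoc A B A, b1]
  calc B = B * A * B := b2.symm
    _ = C * A * B := by rw [h2]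
    _ = C * (A * B) := Matrix.mul_assoc _ _ _
    _ = C * (A * C) := by rw [h1]
    _ = C * A * C := (Matrix.mul_assoc _ _ _).symm
    _ = C := c2

theorem exists_isPinv {m n : ℕ} (A : Matrix (Fin m) (Fin n) ℝ) :
    ∃ B : Matrix (Fin n) (Fin m) ℝ, IsPinv A B := by
  have hG : (Aᵀ * A).IsHermitian := by
    simpa [Matrix.conjTranspose_eq_transpose_of_trivial] using
      Matrix.isHermitian_conjTranspose_mul_self A
  obtain ⟨U, d, hU, hU', hd⟩ : ∃ (U : Matrix (Fin n) (Fin n) ℝ) (d : Fin n → ℝ),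
      Uᵀ * U = 1 ∧ U * Uᵀ = 1 ∧ Aᵀ * A = U * Matrix.diagonal d * Uᵀ := by
    refine ⟨hG.eigenvectorUnitary, hG.eigenvalues, ?_, ?_, ?_⟩
    · have := Unitary.coe_star_mul_self hG.eigenvectorUnitary
      simpa [Matrix.star_eq_conjTranspose, Matrix.conjTranspose_eq_transpose_of_trivial] using this
    · have := Unitary.coe_mul_star_self hG.eigenvectorUnitary
      simpa [Matrix.star_eq_conjTranspose, Matrix.conjTranspose_eq_transpose_of_trivial] using this
    · have := hG.spectral_theorem
      rw [Unitary.conjStarAlgAut_apply] at this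
      simpa [Matrix.star_eq_conjTranspose, Matrix.conjTranspose_eq_transpose_of_trivial,
        Function.comp_def] using this
  set P : Matrix (Fin n) (Fin n) ℝ := U * Matrix.diagonal (fun i => (d i)⁻¹) * Uᵀ with hP
  have key : ∀ a b : Fin n → ℝ, (U * Matrix.diagonal a * Uᵀ) * (U * Matrix.diagonal b * Uᵀ)
      = U * Matrix.diagonal (fun i => a i * b i) * Uᵀ := by
    intro a b
    calc _ = U * Matrix.diagonal a * (Uᵀ * U) * Matrix.diagonal b * Uᵀ := by
          simp only [Matrix.mul_assoc]
      _ = _ := by rw [hU, Matrix.mul_one, Matrix.mul_assoc U, Matrix.diagonal_mul_diagonal]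
  have sym : ∀ a : Fin n → ℝ,
      (U * Matrix.diagonal a * Uᵀ)ᵀ = U * Matrix.diagonal a * Uᵀ := by
    intro a
    simp [Matrix.transpose_mul, Matrix.mul_assoc]
  have hPG : P * (Aᵀ * A) = U * Matrix.diagonal (fun i => (d i)⁻¹ * d i) * Uᵀ := by
    rw [hd, key]
  have hGPG : Aᵀ * A * (P * (Aᵀ * A)) = Aᵀ * A := by
    rw [hPG, hd, key]
    congr 3
    funext i
    by_cases h : d i = 0 <;> simp [h]
  have hPGP : P * (Aᵀ * A) * P = P := by
    rw [hPG, hP, key]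
    congr 3
    funext i
    by_cases h : d i = 0 <;> simp [h]
  have hAP : A * (P * (Aᵀ * A)) = A := by
    have h0 : (A * (P * (Aᵀ * A)) - A)ᴴ * (A * (P * (Aᵀ * A)) - A) = 0 := by
      have hs : (P * (Aᵀ * A))ᵀ = P * (Aᵀ * A) := by rw [hPG, sym]
      rw [Matrix.conjTranspose_eq_transpose_of_trivial, Matrix.transpose_sub,
        Matrix.transpose_mul, hs]
      have : (P * (Aᵀ * A) * Aᵀ - Aᵀ) * (A * (P * (Aᵀ * A)) - A)
          = P * (Aᵀ * A) * (Aᵀ * A * (P * (Aᵀ * A))) - P * (Aᵀ * A) * (Aᵀ * A)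
            - (Aᵀ * A * (P * (Aᵀ * A)) - Aᵀ * A) := by
        simp only [Matrix.sub_mul, Matrix.mul_sub, Matrix.mul_assoc]
        abel
      rw [this, hGPG]
      simp
    exact sub_eq_zero.mp (Matrix.conjTranspose_mul_self_eq_zero.mp h0)
  refine ⟨P * Aᵀ, ?_, ?_, ?_, ?_⟩
  · simpa only [Matrix.mul_assoc] using hAP
  · calc P * Aᵀ * A * (P * Aᵀ) = P * (Aᵀ * A) * P * Aᵀ := by simp only [Matrix.mul_assoc]
      _ = P * Aᵀ := by rw [hPGP]
  · rw [Matrix.transpose_mul, Matrix.transpose_mul, Matrix.transpose_transpose, hP, sym,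
      Matrix.mul_assoc A]
  · rw [Matrix.mul_assoc, hPG, sym]

/-- The Moore-Penrose pseudoinverse. -/
def pinv {m n : ℕ} (A : Matrix (Fin m) (Fin n) ℝ) : Matrix (Fin n) (Fin m) ℝ :=
  (exists_isPinv A).choose

theorem pinv_spec {m n : ℕ} (A : Matrix (Fin m) (Fin n) ℝ) : IsPinv A (pinv A) :=
  (exists_isPinv A).choose_spec

/-- `A = Q R` is a (thin) QR factorization. -/
def IsQR {m q : ℕ} (A Q : Matrix (Fin m) (Fin q) ℝ) (R : Matrix (Fin q) (Fin q) ℝ) : Prop :=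
  Qᵀ * Q = 1 ∧ R.BlockTriangular id ∧ A = Q * R

/-- The smallest singular value `min {‖M y‖ : ‖y‖ = 1}` of the matrix `M` whose columns are the
members of `l` (a list of at most `n` vectors of `ℝⁿ` wherever it is used below). -/
def sigmaMin {n : ℕ} (l : List (E n)) : ℝ :=
  sInf {r | ∃ y : E l.length, ‖y‖ = 1 ∧ r = ‖∑ j, y j • l.get j‖}

/-! ### Derivatives and quadratic interpolation models -/

/-- The Hessian, as the derivative of the gradient; its norm is the induced matrix norm. -/
def hess {n : ℕ} (f : E n → ℝ) (x : E n) : E n →L[ℝ] E n := fderiv ℝ (gradient f) x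

/-- `δ_f(x; D)`, with entries `f (x + d_i) - f x`. -/
def delta {n z : ℕ} (f : E n → ℝ) (x : E n) (D : Matrix (Fin n) (Fin z) ℝ) : E z :=
  WithLp.toLp 2 (fun i => f (x + col D i) - f x)

/-- The generalized simplex gradient `(Dᵀ)† δ_f(x; D)`. -/
def simplexGrad {n z : ℕ} (f : E n → ℝ) (x : E n) (D : Matrix (Fin n) (Fin z) ℝ) : E n :=
  app (pinv Dᵀ) (delta f x D)

/-- The generalized simplex Hessian `(Dᵀ)† δ_{∇_S f}(x; D)`, where the `i`-th row of
`δ_{∇_S f}(x; D)` is `(∇_S f (x + d_i; D) - ∇_S f (x; D))ᵀ`. -/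
def simplexHess {n z : ℕ} (f : E n → ℝ) (x : E n) (D : Matrix (Fin n) (Fin z) ℝ) :
    Matrix (Fin n) (Fin n) ℝ :=
  pinv Dᵀ * Matrix.of (fun i j => simplexGrad f (x + col D i) D j - simplexGrad f x D j)

/-- The determined quadratic model of `f̂ s = f (x + Q s)` in `ℝᵖ`, built on the columns of `R`. -/
def model {n p : ℕ} (f : E n → ℝ) (x : E n) (Q : Matrix (Fin n) (Fin p) ℝ)
    (R : Matrix (Fin p) (Fin p) ℝ) (s : E p) : ℝ :=
  let fhat : E p → ℝ := fun t => f (x + app Q t)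
  fhat 0 + inner ℝ ((2 : ℝ) • simplexGrad fhat 0 R - simplexGrad fhat 0 ((2 : ℝ) • R)) s
    + 1 / 2 * inner ℝ s (app (simplexHess fhat 0 R) s)

/-- `A` is `α`-well aligned for `f` at `x`. -/
def WellAligned {n z : ℕ} (α : ℝ) (f : E n → ℝ) (x : E n) (A : Matrix (Fin n) (Fin z) ℝ) : Prop :=
  α * ‖gradient f x‖ ≤ ‖app Aᵀ (gradient f x)‖

/-! ### The algorithm -/

/-- The input of the algorithm (apart from the objective function). -/
structure Params (n p : ℕ) where
  pRand : ℕ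
  x0 : E n
  Δ0 : ℝ
  Δmin : ℝ
  Δmax : ℝ
  γdec : ℝ
  γinc : ℝ
  η1 : ℝ
  η2 : ℝ
  mu : ℝ
  εrad : ℝ
  εgeo : ℝ
  MA : ℝ
  one_le_pRand : 1 ≤ pRand
  pRand_le : pRand ≤ p
  p_le : p ≤ n
  Δmin_pos : 0 < Δmin
  Δmin_le : Δmin ≤ Δ0
  le_Δmax : Δ0 ≤ Δmax
  γdec_pos : 0 < γdec
  γdec_lt : γdec < 1
  γinc_gt : 1 < γinc
  η1_pos : 0 < η1
  η1_le : η1 ≤ η2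
  η2_lt : η2 < 1
  mu_pos : 0 < mu
  one_le_εrad : 1 ≤ εrad
  εgeo_pos : 0 < εgeo
  one_le_MA : 1 ≤ MA

/-- One pass of the direction removing algorithm: remove a direction whose score
`θ_i = σ_min (M_i) * max (‖d_i‖⁴ / Δ⁴) 1` is largest, `M_i` being the matrix without `d_i`. -/
def RemoveOne {n : ℕ} (Δ : ℝ) (l l' : List (E n)) : Prop :=
  let θ : Fin l.length → ℝ := fun i =>
    sigmaMin (l.eraseIdx i) * max (‖l.get i‖ ^ 4 / Δ ^ 4) 1
  ∃ i : Fin l.length, (∀ j, θ j ≤ θ i) ∧ l' = l.eraseIdx i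

/-- The direction removing algorithm with `r` directions to be removed. -/
inductive RemoveMany {n : ℕ} (Δ : ℝ) : ℕ → List (E n) → List (E n) → Prop
  | zero (l : List (E n)) : RemoveMany Δ 0 l l
  | succ {r : ℕ} {l l₁ l₂ : List (E n)} (h : RemoveOne Δ l l₁) (h' : RemoveMany Δ r l₁ l₂) :
      RemoveMany Δ (r + 1) l l₂

/-- The loop "while the matrix is not empty and `σ_min < ε_geo`, remove one direction". -/
inductive Prune {n : ℕ} (Δ εgeo : ℝ) : List (E n) → List (E n) → Prop
  | done {l : List (E n)} (h : l = [] ∨ εgeo ≤ sigmaMin l) : Prune Δ εgeo l l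
  | step {l l₁ l₂ : List (E n)} (hl : l ≠ []) (hσ : sigmaMin l < εgeo) (h : RemoveOne Δ l l₁)
      (h' : Prune Δ εgeo l₁ l₂) : Prune Δ εgeo l l₂

/-- `l` is a possible output `D^U_{k+1}` of the algorithm that recycles directions: `x`, `x'` are
the current and next iterates, `s` the step, `D` the current direction matrix, and `Δ` the new
trust-region radius. -/
def CreateDU {n p : ℕ} (P : Params n p) (x x' s : E n) (D : Matrix (Fin n) (Fin p) ℝ) (Δ : ℝ)
    (l : List (E n)) : Prop :=
  ∃ l₀ l₁ : List (E n),
    l₀.length = p ∧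
    (∀ d ∈ l₀, d = x + s - x' ∨ ∃ u ∈ 0 :: cols D, ∃ v ∈ 0 :: cols D, d = x + u + v - x') ∧
    RemoveMany Δ P.pRand l₀ l₁ ∧
    Prune Δ P.εgeo (l₁.filter (fun d => ‖d‖ ≤ P.εrad * Δ)) l

/-- `DR` is the output of the direction generating algorithm run on the matrix `A`, for the kept
directions `DU` and the length `Δ`: `Ã = A - B Bᵀ A` with `B` an orthonormal basis of the span of
`DU` (so that `Ã = A` if there are no kept directions), `Ã = Q̃ R̃`, and `DR` lists the columns of
`Δ Q̃`. As the main algorithm demands, the directions are mutually orthogonal, of length `Δ`, and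
orthogonal to all kept ones. -/
def Generate {n q : ℕ} (P : Params n q) {r : ℕ} (A : Matrix (Fin n) (Fin r) ℝ) (Δ : ℝ)
    (DU DR : List (E n)) : Prop :=
  A.rank = r ∧ opNorm A ≤ P.MA ∧
  (∃ (m : ℕ) (B : Matrix (Fin n) (Fin m) ℝ) (Qt : Matrix (Fin n) (Fin r) ℝ)
      (Rt : Matrix (Fin r) (Fin r) ℝ),
    Bᵀ * B = 1 ∧
    Submodule.span ℝ {d | d ∈ cols B} = Submodule.span ℝ {d | d ∈ DU} ∧
    IsQR (A - B * Bᵀ * A) Qt Rt ∧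
    DR = cols (Δ • Qt)) ∧
  (∀ d ∈ DR, ‖d‖ = Δ) ∧
  DR.Pairwise (fun d e => inner ℝ d e = 0) ∧
  (∀ d ∈ DR, ∀ e ∈ DU, inner ℝ d e = 0)

/-- Everything the algorithm computes, indexed by the iteration. The matrix `D k` consists of
`kept k` recycled directions followed by `p - kept k` generated ones, unless it was obtained by
scaling `D (k - 1)`; `A k (p - kept k)` is the matrix from which these were generated. Values
beyond the last iteration are meaningless. -/
structure Trace (n p : ℕ) where
  x : ℕ → E n
  Δ : ℕ → ℝ
  D : ℕ → Matrix (Fin n) (Fin p) ℝ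
  Q : ℕ → Matrix (Fin n) (Fin p) ℝ
  R : ℕ → Matrix (Fin p) (Fin p) ℝ
  s : ℕ → E p
  kept : ℕ → ℕ
  A : ℕ → (r : ℕ) → Matrix (Fin n) (Fin r) ℝ

namespace Trace

variable {n p : ℕ}

/-- The model `m̂_k`. -/
def mhat (T : Trace n p) (f : E n → ℝ) (k : ℕ) : E p → ℝ := model f (T.x k) (T.Q k) (T.R k)

/-- The criticality test succeeds in iteration `k`. -/
def Critical (T : Trace n p) (f : E n → ℝ) (P : Params n p) (k : ℕ) : Prop :=
  P.mu * ‖gradient (T.mhat f k) 0‖ < T.Δ k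

/-- The full step `s_k = Q_k ŝ_k`. -/
def fullStep (T : Trace n p) (k : ℕ) : E n := app (T.Q k) (T.s k)

/-- The ratio `ρ_k` of actual to predicted decrease. -/
def rho (T : Trace n p) (f : E n → ℝ) (k : ℕ) : ℝ :=
  (f (T.x k) - f (T.x k + T.fullStep k)) / (T.mhat f k 0 - T.mhat f k (T.s k))

/-- The stopping test succeeds at the end of iteration `k`. -/
def StopsAt (T : Trace n p) (P : Params n p) (k : ℕ) : Prop := T.Δ (k + 1) < P.Δmin

/-- Iteration `k` is performed: the stopping test failed in all earlier iterations. -/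
def Reached (T : Trace n p) (P : Params n p) (k : ℕ) : Prop := ∀ j < k, ¬ T.StopsAt P j

/-- `D k` is built from freshly sampled directions (and not by scaling `D (k - 1)`). -/
def Fresh (T : Trace n p) (f : E n → ℝ) (P : Params n p) (k : ℕ) : Prop :=
  k = 0 ∨ ∃ j, k = j + 1 ∧ T.Reached P j ∧ ¬ T.Critical f P j

/-- The direction matrix `D k` is `[DU DR]` with `DR` sampled. -/
def Assembled (T : Trace n p) (P : Params n p) (k : ℕ) (DU : List (E n)) : Prop :=
  T.kept k = DU.length ∧
  ∃ DR : List (E n), cols (T.D k) = DU ++ DR ∧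
    Generate P (T.A k (p - T.kept k)) (T.Δ k) DU DR

open Classical in
/-- The new trust-region radius after a trust-region step. -/
def newRadius (T : Trace n p) (f : E n → ℝ) (P : Params n p) (k : ℕ) : ℝ :=
  if T.rho f k < P.η1 then P.γdec * T.Δ k
  else if P.η2 < T.rho f k ∧ 0.95 * T.Δ k ≤ ‖T.s k‖ then min (P.γinc * T.Δ k) P.Δmax
  else T.Δ k

/-- Iteration `k` of the main algorithm. -/
structure Iteration (T : Trace n p) (f : E n → ℝ) (P : Params n p) (k : ℕ) : Prop where
  qr : IsQR (T.D k) (T.Q k) (T.R k)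
  critical : T.Critical f P k →
    T.Δ (k + 1) = P.γdec * T.Δ k ∧ T.x (k + 1) = T.x k ∧ T.D (k + 1) = P.γdec • T.D k
  step_le : ¬ T.Critical f P k → ‖T.s k‖ ≤ T.Δ k
  radius : ¬ T.Critical f P k → T.Δ (k + 1) = T.newRadius f P k
  next_le_step : ¬ T.Critical f P k → f (T.x (k + 1)) ≤ f (T.x k + T.fullStep k)
  next_le_sample : ¬ T.Critical f P k → ∀ u ∈ 0 :: cols (T.D k), ∀ v ∈ 0 :: cols (T.D k),
    f (T.x (k + 1)) ≤ f (T.x k + u + v)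
  directions : ¬ T.Critical f P k → ∃ DU : List (E n),
    CreateDU P (T.x k) (T.x (k + 1)) (T.fullStep k) (T.D k) (T.Δ (k + 1)) DU ∧
    T.Assembled P (k + 1) DU

/-- `T` is a run of the algorithm: the initialization is followed, and then every iteration up to
and including the one in which the stopping test succeeds. -/
structure IsRun (T : Trace n p) (f : E n → ℝ) (P : Params n p) : Prop where
  x_zero : T.x 0 = P.x0
  Δ_zero : T.Δ 0 = P.Δ0
  D_zero : T.Assembled P 0 []
  iteration : ∀ k, T.Reached P k → T.Iteration f P k

/-- `K_ε`, the first index `k` with `‖∇f(x_k)‖ ≤ ε` (`⊤` if there is none). -/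
def hitting (T : Trace n p) (f : E n → ℝ) (ε : ℝ) : ℕ∞ :=
  sInf ((fun k : ℕ => (k : ℕ∞)) '' {k | ‖gradient f (T.x k)‖ ≤ ε})

/-- The index of the iteration in which the stopping test succeeds, i.e. of the last iteration
(`⊤` if there is none). -/
def stopping (T : Trace n p) (P : Params n p) : ℕ∞ :=
  sInf ((fun k : ℕ => (k : ℕ∞)) '' {k | T.StopsAt P k})

end Trace

/-- The law of an `n × r` matrix with independent `N(0, 1/r)` entries, conditioned on having full
column rank and norm at most `M`. -/
def samplingLaw (n r : ℕ) (M : ℝ) : Measure (Fin n → Fin r → ℝ) :=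
  ProbabilityTheory.cond
    (Measure.pi fun _ : Fin n => Measure.pi fun _ : Fin r => gaussianReal 0 (1 / (r : ℝ≥0)))
    {a | (Matrix.of a).rank = r ∧ opNorm (Matrix.of a) ≤ M}

/-- `X` is a random run of the algorithm. The σ-algebra `ℱ k` is the history at the time when the
random part of `D k` is about to be sampled: it knows the iterate, the radius and the recycled
directions of iteration `k` and everything that earlier iterations computed. -/
structure IsRandomRun {n p : ℕ} {Ω : Type*} [mΩ : MeasurableSpace Ω] (μ : Measure Ω)
    (ℱ : Filtration ℕ mΩ) (f : E n → ℝ) (P : Params n p) (X : Ω → Trace n p) : Prop where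
  isRun : ∀ᵐ ω ∂μ, (X ω).IsRun f P
  meas_x : ∀ k, Measurable[ℱ k] fun ω => (X ω).x k
  meas_Δ : ∀ k, Measurable[ℱ k] fun ω => (X ω).Δ k
  meas_kept : ∀ k, Measurable[ℱ k] fun ω => (X ω).kept k
  meas_DU : ∀ k i (j : Fin p),
    Measurable[ℱ k] fun ω => if (j : ℕ) < (X ω).kept k then (X ω).D k i j else 0
  meas_D : ∀ k i j, Measurable[ℱ (k + 1)] fun ω => (X ω).D k i j
  meas_Q : ∀ k i j, Measurable[ℱ (k + 1)] fun ω => (X ω).Q k i j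
  meas_R : ∀ k i j, Measurable[ℱ (k + 1)] fun ω => (X ω).R k i j
  meas_s : ∀ k, Measurable[ℱ (k + 1)] fun ω => (X ω).s k
  meas_A : ∀ k r i j, Measurable[ℱ (k + 1)] fun ω => (X ω).A k r i j
  meas_critical : ∀ k, MeasurableSet[ℱ (k + 1)] {ω | (X ω).Critical f P k}
  /-- Given the history, the sampled matrix has the prescribed law. -/
  sampling : ∀ (k r : ℕ) (H : Set Ω), MeasurableSet[ℱ k] H →
    (∀ ω ∈ H, (X ω).Fresh f P k ∧ p - (X ω).kept k = r) →
    ∀ S : Set (Fin n → Fin r → ℝ), MeasurableSet S →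
      μ (H ∩ {ω | (fun i j => (X ω).A k r i j) ∈ S}) = μ H * samplingLaw n r P.MA S

/-! ### Assumptions -/

/-- `f` is of class `C²` and its Hessian is Lipschitz continuous with constant `L`. -/
def Smooth2Plus {n : ℕ} (f : E n → ℝ) (L : ℝ≥0) : Prop :=
  ContDiff ℝ 2 f ∧ LipschitzWith L (hess f)

/-- The model Hessians are bounded by `κ` (a model is quadratic, so its Hessian is constant). -/
def ModelHessBound {n p : ℕ} {Ω : Type*} [MeasurableSpace Ω] (μ : Measure Ω) (f : E n → ℝ)
    (P : Params n p) (X : Ω → Trace n p) (κ : ℝ) : Prop :=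
  ∀ᵐ ω ∂μ, ∀ k, (X ω).Reached P k → ‖hess ((X ω).mhat f k) 0‖ ≤ κ

/-- Every trust-region step achieves the Cauchy decrease with constant `c`. -/
def CauchyDecrease {n p : ℕ} {Ω : Type*} [MeasurableSpace Ω] (μ : Measure Ω) (f : E n → ℝ)
    (P : Params n p) (X : Ω → Trace n p) (c : ℝ) : Prop :=
  ∀ᵐ ω ∂μ, ∀ k, (X ω).Reached P k → ¬ (X ω).Critical f P k →
    c * ‖gradient ((X ω).mhat f k) 0‖ *
        min ((X ω).Δ k)
          (‖gradient ((X ω).mhat f k) 0‖ / max ‖hess ((X ω).mhat f k) 0‖ 1)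
      ≤ (X ω).mhat f k 0 - (X ω).mhat f k ((X ω).s k)

/-- Whenever directions are sampled for an iteration that is performed, the direction matrix is
`α`-well aligned with conditional probability at least `1 - δ` given the history. -/
def SubspaceQuality {n p : ℕ} {Ω : Type*} [mΩ : MeasurableSpace Ω] (μ : Measure Ω)
    (ℱ : Filtration ℕ mΩ) (f : E n → ℝ) (P : Params n p) (X : Ω → Trace n p) (α δ : ℝ) : Prop :=
  ∀ k, ∀ᵐ ω ∂μ, (X ω).Reached P k → (X ω).Fresh f P k →
    1 - δ ≤ (μ⟦{ω' | WellAligned α f ((X ω').x k) ((X ω').D k)} | ℱ k⟧) ω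

/-! ### Constants -/

namespace Params

variable {n p : ℕ}

/-- Bound on `‖R̂⁻ᵀ‖`. -/
def MR (P : Params n p) : ℝ := max (1 / P.εgeo) (1 / P.Δmin) * P.εrad * P.Δmax

/-- The gradient error constant of the fully quadratic models (error at most `κ Δ²`). -/
def κeg (P : Params n p) (L : ℝ) : ℝ :=
  3 * √p * L * P.MR * (2 * p * P.MR ^ 2 + 1) * P.εrad ^ 2

/-- The gradient error constant of the models as fully linear ones (error at most `κ Δ`); it is
`κeg` unless `3 * (2 * p * MR ^ 2 + 1) < Δmax`. -/
def κlin (P : Params n p) (L : ℝ) : ℝ :=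
  P.κeg L * max 1 (P.Δmax / (3 * (2 * p * P.MR ^ 2 + 1)))

/-- Bound on `‖D_k‖`. -/
def MD (P : Params n p) : ℝ := P.εrad * P.Δmax * √p + P.Δmax

/-- `ε_g(ε)`. -/
def εg (P : Params n p) (L α ε : ℝ) : ℝ := α * ε / ((P.κlin L * P.mu + 1) * P.MD)

/-- `φ(ε)`; `gap` stands for `f(x_0) - f_low`. -/
def phi (P : Params n p) (L α gap κH c₁ ε : ℝ) : ℝ :=
  gap / (P.η1 * c₁ * P.εg L α ε * min (P.εg L α ε / κH) P.Δmin)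

def C1 (P : Params n p) : ℝ := (Real.log (1 / P.γdec))⁻¹ * Real.log P.γinc

def C2 (P : Params n p) : ℝ := (Real.log (1 / P.γdec))⁻¹ * Real.log (P.Δ0 / P.Δmin)

/-- `ψ(ε)`. -/
def psi (P : Params n p) (L α gap κH c₁ ε : ℝ) : ℝ :=
  P.phi L α gap κH c₁ ε + P.C2 / (P.C1 + 1)

def C3 (P : Params n p) (δ : ℝ) : ℝ :=
  (1 - δ - P.C1 / (P.C1 + 1)) ^ 2 / (8 * (1 - δ))

/-- `K_min(ε)`. -/
def Kmin (P : Params n p) (L α gap κH c₁ δ ε : ℝ) : ℝ :=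
  2 * P.psi L α gap κH c₁ ε / (1 - δ - P.C1 / (P.C1 + 1)) - 1

/-- The bound on the expected number of iterations. -/
def bound (P : Params n p) (L α gap κH c₁ δ ε : ℝ) : ℝ :=
  P.Kmin L α gap κH c₁ δ ε
    + Real.exp (-P.C3 δ * (P.Kmin L α gap κH c₁ δ ε + 1)) / (1 - Real.exp (-P.C3 δ))

end Params

end QARSTA

end

/-! The proof counts iterations along each path and then takes expectations once. Call an iteration
decreasing if it shrinks the radius, and good if its direction matrix is aligned with the gradient,
up to a factor that compensates for critical shrinkings.

Decreasing iterations are rare: the radius stays between `Δmin` and `Δmax` while iterations are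
performed, so taking logarithms bounds their number among the first k by C₁k/(C₁+1) + C₂/(C₁+1)
(`sum_decreasing_le`). Iterations that are good and not decreasing are few: as long as the gradient
is at least ε, each lowers f by a fixed amount, so there are at most φ(ε) of them (`sum_good_le`).
That amount comes from the model. Its gradient is a Richardson extrapolation of difference
quotients, hence close to the projected gradient (`norm_gradient_model_sub_le`), provided the
direction matrices stay well conditioned at the scale of the radius (`IsRun.geometry`). Alignment
and failure of the criticality test then force the model gradient to be at least ε_g
(`εg_le_norm_gradient_mhat`).

Assumption (5) concerns only freshly sampled matrices. An iteration with inherited directions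
therefore counts as a success by convention (`AlignedIfFresh`), and an iteration with conditional
success probability at least 1 - δ is available at every index. Such vacuous successes are paid for
by the critical, hence decreasing, iterations just before them (`sum_alignedIfFresh_le_sum`). On
every path the first k iterations thus contain at most ψ + C₁k/(C₁+1) successes, while the expected
number is at least 1 - δ per iteration. Comparing the two gives E[min(K_ε, τ)] ≤ (ψ + δ)/(1 - δ -
C₁/(C₁+1)) (`sum_measureReal_survivalSet_le`), with no concentration inequality; an elementary
estimate shows that this is at most B(ε) (`le_bound`). -/

namespace QARSTA

/-! ### Matrices acting on Euclidean spaces -/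

section LinearAlgebra

variable {m n p : ℕ}

theorem app_apply (A : Matrix (Fin m) (Fin n) ℝ) (v : E n) (i : Fin m) :
    app A v i = ∑ j, A i j * v j := by
  simp [app, Matrix.toLpLin_apply, Matrix.mulVec, dotProduct]

@[simp] theorem col_apply (A : Matrix (Fin m) (Fin n) ℝ) (i : Fin m) (j : Fin n) :
    col A j i = A i j := rfl

theorem app_eq_sum_smul_col (A : Matrix (Fin m) (Fin n) ℝ) (v : E n) :
    app A v = ∑ j, v j • col A j := by
  ext i
  simp [app_apply, mul_comm]

theorem app_mul (A : Matrix (Fin m) (Fin n) ℝ) (B : Matrix (Fin n) (Fin p) ℝ) (v : E p) :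
    app (A * B) v = app A (app B v) := by
  simp [app, Matrix.toLpLin_apply]

theorem app_one (v : E n) : app (1 : Matrix (Fin n) (Fin n) ℝ) v = v := by
  simp [app]

theorem app_sub (A : Matrix (Fin m) (Fin n) ℝ) (v w : E n) :
    app A (v - w) = app A v - app A w := map_sub _ _ _

theorem app_smul (A : Matrix (Fin m) (Fin n) ℝ) (c : ℝ) (v : E n) :
    app A (c • v) = c • app A v := map_smul _ _ _

theorem app_zero (A : Matrix (Fin m) (Fin n) ℝ) : app A 0 = 0 := map_zero _

theorem smul_app (c : ℝ) (A : Matrix (Fin m) (Fin n) ℝ) (v : E n) :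
    app (c • A) v = c • app A v := by
  simp [app]

theorem col_smul (c : ℝ) (A : Matrix (Fin m) (Fin n) ℝ) (j : Fin n) :
    col (c • A) j = c • col A j := rfl

theorem col_mul (A : Matrix (Fin m) (Fin n) ℝ) (B : Matrix (Fin n) (Fin p) ℝ) (j : Fin p) :
    col (A * B) j = app A (col B j) := by
  ext i
  simp [app_apply, Matrix.mul_apply]

theorem app_transpose_apply (A : Matrix (Fin m) (Fin n) ℝ) (w : E m) (j : Fin n) :
    app Aᵀ w j = inner ℝ (col A j) w := by
  simp [app_apply, PiLp.inner_apply, mul_comm]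

theorem inner_app (A : Matrix (Fin m) (Fin n) ℝ) (v : E n) (w : E m) :
    inner ℝ (app A v) w = inner ℝ v (app Aᵀ w) := by
  rw [app_eq_sum_smul_col, sum_inner]
  simp_rw [PiLp.inner_apply (𝕜 := ℝ) v, app_transpose_apply, real_inner_smul_left]
  simp [mul_comm]

theorem norm_app_of_transpose_mul_self {Q : Matrix (Fin m) (Fin n) ℝ} (hQ : Qᵀ * Q = 1) (v : E n) :
    ‖app Q v‖ = ‖v‖ := by
  have h : ‖app Q v‖ ^ 2 = ‖v‖ ^ 2 := by
    rw [← real_inner_self_eq_norm_sq, inner_app, ← app_mul, hQ, app_one,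
      real_inner_self_eq_norm_sq]
  exact (sq_eq_sq₀ (norm_nonneg _) (norm_nonneg _)).1 h

theorem norm_le_sqrt_mul {v : E p} {b : ℝ} (hb : 0 ≤ b) (h : ∀ i, |v i| ≤ b) :
    ‖v‖ ≤ √p * b := by
  rw [EuclideanSpace.norm_eq, ← Real.sqrt_sq hb, ← Real.sqrt_mul (Nat.cast_nonneg _)]
  apply Real.sqrt_le_sqrt
  calc ∑ i, ‖v i‖ ^ 2 ≤ ∑ _i : Fin p, b ^ 2 := by
        refine Finset.sum_le_sum fun i _ => ?_
        rw [Real.norm_eq_abs]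
        exact pow_le_pow_left₀ (abs_nonneg _) (h i) 2
    _ = p * b ^ 2 := by simp

/-- A square matrix and its transpose have the same lower bound. -/
theorem mul_norm_le_norm_app_transpose {R : Matrix (Fin p) (Fin p) ℝ} {σ : ℝ} (hσ : 0 < σ)
    (hR : ∀ y, σ * ‖y‖ ≤ ‖app R y‖) (z : E p) : σ * ‖z‖ ≤ ‖app Rᵀ z‖ := by
  have hinj : Function.Injective (Matrix.toEuclideanLin R) := by
    refine (injective_iff_map_eq_zero _).2 fun y hy => ?_
    have h : σ * ‖y‖ ≤ 0 := by simpa [app, hy] using hR y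
    exact norm_le_zero_iff.1 (by nlinarith)
  -- A square injective map is onto, so z = R y. Then ‖z‖² = ⟨y, Rᵀz⟩, and ‖y‖ ≤ ‖z‖/σ finishes by
  -- Cauchy-Schwarz.
  obtain ⟨y, hy⟩ := LinearMap.injective_iff_surjective.1 hinj z
  change app R y = z at hy
  rcases (norm_nonneg z).eq_or_lt with hz | hz
  · rw [← hz]
    simp
  have h1 : ‖z‖ ^ 2 ≤ ‖y‖ * ‖app Rᵀ z‖ := by
    calc ‖z‖ ^ 2 = inner ℝ (app R y) z := by rw [hy, real_inner_self_eq_norm_sq]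
      _ = inner ℝ y (app Rᵀ z) := inner_app _ _ _
      _ ≤ _ := real_inner_le_norm _ _
  have h2 : σ * ‖y‖ ≤ ‖z‖ := hy ▸ hR y
  refine le_of_mul_le_mul_right ?_ hz
  calc σ * ‖z‖ * ‖z‖ = σ * ‖z‖ ^ 2 := by ring
    _ ≤ σ * (‖y‖ * ‖app Rᵀ z‖) := by gcongr
    _ = σ * ‖y‖ * ‖app Rᵀ z‖ := by ring
    _ ≤ ‖z‖ * ‖app Rᵀ z‖ := by gcongr
    _ = ‖app Rᵀ z‖ * ‖z‖ := mul_comm _ _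

theorem mul_pinv_eq_one {A : Matrix (Fin p) (Fin p) ℝ} (hA : IsUnit A) : A * pinv A = 1 :=
  hA.mul_right_cancel (by rw [(pinv_spec A).1, one_mul])

/-- Together with `mul_pinv_eq_one`, this turns the pseudoinverses in the model into genuine right
inverses. -/
theorem isUnit_transpose_of_bounded_below {R : Matrix (Fin p) (Fin p) ℝ} {σ : ℝ} (hσ : 0 < σ)
    (hR : ∀ y, σ * ‖y‖ ≤ ‖app R y‖) : IsUnit Rᵀ := by
  refine Matrix.mulVec_injective_iff_isUnit.1 fun v w hvw => ?_
  have h := mul_norm_le_norm_app_transpose hσ hR (WithLp.toLp 2 (v - w))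
  have h0 : app Rᵀ (WithLp.toLp 2 (v - w)) = 0 := by
    simp only [app, Matrix.toLpLin_apply, Matrix.mulVec_sub]
    rw [sub_eq_zero.2 hvw]
    rfl
  rw [h0, norm_zero] at h
  have h1 : WithLp.toLp 2 (v - w) = (0 : E p) := norm_le_zero_iff.1 (by nlinarith)
  have h2 : v - w = 0 := by simpa using congrArg WithLp.ofLp h1
  exact sub_eq_zero.1 h2

end LinearAlgebra

/-! ### Taylor expansion and the gradient of the model -/

section Model

variable {n p : ℕ}

theorem Smooth2Plus.hasDerivAt_line {f : E n → ℝ} {L : ℝ≥0} (hf : Smooth2Plus f L) (x d : E n)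
    (t : ℝ) :
    HasDerivAt (fun t : ℝ => f (x + t • d)) (inner ℝ (gradient f (x + t • d)) d) t := by
  have h1 : HasDerivAt (fun t : ℝ => x + t • d) d t := by
    simpa using ((hasDerivAt_id t).smul_const d).const_add x
  have h2 := (hf.1.differentiable (by norm_num) (x + t • d)).hasGradientAt
  exact h2.hasFDerivAt.comp_hasDerivAt t h1

theorem Smooth2Plus.contDiff_gradient {f : E n → ℝ} {L : ℝ≥0} (hf : Smooth2Plus f L) :
    ContDiff ℝ 1 (gradient f) :=
  (InnerProductSpace.toDual ℝ (E n)).symm.contDiff.comp (hf.1.fderiv_right (by norm_num))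

theorem Smooth2Plus.hasDerivAt_gradient_line {f : E n → ℝ} {L : ℝ≥0} (hf : Smooth2Plus f L)
    (x d : E n) (t : ℝ) :
    HasDerivAt (fun t : ℝ => inner ℝ (gradient f (x + t • d)) d)
      (inner ℝ (hess f (x + t • d) d) d) t := by
  have h1 : HasDerivAt (fun t : ℝ => x + t • d) d t := by
    simpa using ((hasDerivAt_id t).smul_const d).const_add x
  have h2 := (hf.contDiff_gradient.differentiable (by norm_num) (x + t • d)).hasFDerivAt
  have h3 := (h2.comp_hasDerivAt t h1).inner ℝ (hasDerivAt_const t d)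
  rw [inner_zero_right, zero_add] at h3
  exact h3

/-- Richardson extrapolation: the weights 2 and -1/2 at steps d and 2d reproduce the linear term and
cancel the quadratic one. The error as a function of t on the segment has second derivative 2(G'(t)
- G'(2t)), which the Lipschitz Hessian bounds by 2Ct; two comparison steps integrate this back. -/
theorem Smooth2Plus.abs_extrapolation_le {f : E n → ℝ} {L : ℝ≥0} (hf : Smooth2Plus f L)
    (x d : E n) :
    |2 * (f (x + d) - f x) - 1 / 2 * (f (x + (2 : ℝ) • d) - f x) - inner ℝ (gradient f x) d|
      ≤ L * ‖d‖ ^ 3 := by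
  set C : ℝ := L * ‖d‖ ^ 3 with hC
  have hC0 : 0 ≤ C := by positivity
  set h : ℝ → ℝ := fun t => f (x + t • d) with hh
  set G : ℝ → ℝ := fun t => inner ℝ (gradient f (x + t • d)) d with hG
  set G' : ℝ → ℝ := fun t => inner ℝ (hess f (x + t • d) d) d with hG'
  have dh : ∀ t, HasDerivAt h (G t) t := hf.hasDerivAt_line x d
  have dG : ∀ t, HasDerivAt G (G' t) t := hf.hasDerivAt_gradient_line x d
  have d2 : ∀ t : ℝ, HasDerivAt (fun t : ℝ => 2 * t) 2 t := fun t => by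
    simpa using (hasDerivAt_id t).const_mul 2
  have dE' : ∀ t, HasDerivAt (fun t => 2 * G t - G (2 * t) - G 0) (2 * G' t - G' (2 * t) * 2) t :=
    fun t => (((dG t).const_mul 2).sub ((dG (2 * t)).comp t (d2 t))).sub_const _
  have dE : ∀ t, HasDerivAt (fun t => 2 * (h t - h 0) - 1 / 2 * (h (2 * t) - h 0) - t * G 0)
      (2 * G t - G (2 * t) - G 0) t := fun t => by
    have := ((((dh t).sub_const (h 0)).const_mul 2).sub
      ((((dh (2 * t)).comp t (d2 t)).sub_const (h 0)).const_mul (1 / 2))).sub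
      ((hasDerivAt_id t).mul_const (G 0))
    have e : 2 * G t - G (2 * t) - G 0 = 2 * G t - 1 / 2 * (G (2 * t) * 2) - 1 * G 0 := by ring
    rw [e]
    exact this
  have bound2 : ∀ t ∈ Set.Ico (0 : ℝ) 1, ‖2 * G' t - G' (2 * t) * 2‖ ≤ C * (2 * t) := by
    intro t ht
    have h1 : 2 * G' t - G' (2 * t) * 2
        = 2 * inner ℝ ((hess f (x + t • d) - hess f (x + (2 * t) • d)) d) d := by
      simp only [hG', sub_apply, inner_sub_left]
      ring
    have h2 : ‖hess f (x + t • d) - hess f (x + (2 * t) • d)‖ ≤ L * (t * ‖d‖) := by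
      have h3 := hf.2.dist_le_mul (x + t • d) (x + (2 * t) • d)
      rw [dist_eq_norm, dist_eq_norm] at h3
      have h4 : x + t • d - (x + (2 * t) • d) = -(t • d) := by module
      rwa [h4, norm_neg, norm_smul, Real.norm_eq_abs, abs_of_nonneg ht.1] at h3
    rw [h1, norm_mul, Real.norm_ofNat]
    calc 2 * ‖inner ℝ ((hess f (x + t • d) - hess f (x + (2 * t) • d)) d) d‖
        ≤ 2 * ((L * (t * ‖d‖) * ‖d‖) * ‖d‖) := by
          gcongr
          refine (norm_inner_le_norm _ _).trans ?_
          gcongr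
          exact (ContinuousLinearMap.le_opNorm _ _).trans (by gcongr)
      _ = C * (2 * t) := by rw [hC]; ring
  have bound1 : ∀ t ∈ Set.Icc (0 : ℝ) 1, ‖2 * G t - G (2 * t) - G 0‖ ≤ C * t ^ 2 := by
    intro t ht
    refine image_norm_le_of_norm_deriv_right_le_deriv_boundary (a := 0) (b := 1)
      (B := fun t => C * t ^ 2) (B' := fun t => C * (2 * t))
      (fun t _ => (dE' t).continuousAt.continuousWithinAt) (fun t _ => (dE' t).hasDerivWithinAt)
      ?_ (fun t => ?_) bound2 ht
    · have h0 : 2 * G 0 - G (2 * 0) - G 0 = 0 := by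
        rw [mul_zero]
        ring
      rw [h0]
      simp
    · simpa using (hasDerivAt_pow 2 t).const_mul C
  have bound0 := image_norm_le_of_norm_deriv_right_le_deriv_boundary (a := 0) (b := 1)
      (B := fun t => C * t) (B' := fun _ => C)
      (fun t _ => (dE t).continuousAt.continuousWithinAt) (fun t _ => (dE t).hasDerivWithinAt)
      (by simp) (fun t => by simpa using (hasDerivAt_id t).const_mul C)
      (fun t ht => (bound1 t ⟨ht.1, ht.2.le⟩).trans (by
        -- A crude bound: keeping t² would give C/3, but C suffices for the constant `κlin`.
        have : t ^ 2 ≤ 1 := by nlinarith [ht.1, ht.2]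
        nlinarith)) (Set.right_mem_Icc.2 zero_le_one)
  simpa [hh, hG] using bound0

theorem gradient_model (f : E n → ℝ) (x : E n) (Q : Matrix (Fin n) (Fin p) ℝ)
    (R : Matrix (Fin p) (Fin p) ℝ) :
    gradient (model f x Q R) 0 =
      (2 : ℝ) • simplexGrad (fun t => f (x + app Q t)) 0 R
        - simplexGrad (fun t => f (x + app Q t)) 0 ((2 : ℝ) • R) := by
  set v := (2 : ℝ) • simplexGrad (fun t => f (x + app Q t)) 0 R
        - simplexGrad (fun t => f (x + app Q t)) 0 ((2 : ℝ) • R) with hv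
  set H := LinearMap.toContinuousLinearMap
    (Matrix.toEuclideanLin (simplexHess (fun t => f (x + app Q t)) 0 R)) with hH
  refine HasGradientAt.gradient ?_
  rw [hasGradientAt_iff_hasFDerivAt]
  -- The quadratic part has zero derivative at the origin whether or not the simplex Hessian is
  -- symmetric.
  have h1 : HasFDerivAt (fun s : E p => inner ℝ s (H s)) (0 : E p →L[ℝ] ℝ) 0 := by
    refine ((hasFDerivAt_id (0 : E p)).inner ℝ H.hasFDerivAt).congr_fderiv ?_
    ext s
    simp
  have h2 : HasFDerivAt (fun s : E p => inner ℝ v s) (InnerProductSpace.toDual ℝ (E p) v) 0 :=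
    (InnerProductSpace.toDual ℝ (E p) v).hasFDerivAt
  have h3 := (h2.const_add (f (x + app Q 0))).add (h1.const_mul (1 / 2))
  simp only [smul_zero, add_zero] at h3
  exact h3

/-- The gradient of the interpolation model approximates the gradient in the subspace. -/
theorem norm_gradient_model_sub_le {f : E n → ℝ} {L : ℝ≥0} (hf : Smooth2Plus f L) (x : E n)
    {D Q : Matrix (Fin n) (Fin p) ℝ} {R : Matrix (Fin p) (Fin p) ℝ} (hqr : IsQR D Q R)
    {σ r : ℝ} (hσ : 0 < σ) (hr : 0 ≤ r) (hD : ∀ y, σ * ‖y‖ ≤ ‖app D y‖)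
    (hcol : ∀ i, ‖col D i‖ ≤ r) :
    σ * ‖gradient (model f x Q R) 0 - app Qᵀ (gradient f x)‖ ≤ √p * (L * r ^ 3) := by
  obtain ⟨hQ, -, rfl⟩ := hqr
  have hR : ∀ y, σ * ‖y‖ ≤ ‖app R y‖ := fun y => by
    simpa [app_mul, norm_app_of_transpose_mul_self hQ] using hD y
  have hunit := isUnit_transpose_of_bounded_below hσ hR
  have hunit2 : IsUnit ((2 : ℝ) • R)ᵀ := by
    refine isUnit_transpose_of_bounded_below (σ := σ) hσ fun y => (hR y).trans ?_
    rw [smul_app, norm_smul, Real.norm_ofNat]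
    linarith [norm_nonneg (app R y)]
  refine (mul_norm_le_norm_app_transpose hσ hR _).trans (norm_le_sqrt_mul (by positivity) fun i => ?_)
  have e1 : ∀ w : E p, app Rᵀ (app (pinv Rᵀ) w) = w := fun w => by
    rw [← app_mul, mul_pinv_eq_one hunit, app_one]
  -- The inverse of 2Rᵀ is half that of Rᵀ; this is the origin of the weight 1/2 in the
  -- extrapolation formula.
  have e2 : ∀ w : E p, app Rᵀ (app (pinv ((2 : ℝ) • R)ᵀ) w) = (1 / 2 : ℝ) • w := fun w => by
    have h : w = (2 : ℝ) • app Rᵀ (app (pinv ((2 : ℝ) • R)ᵀ) w) := by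
      rw [← smul_app, ← Matrix.transpose_smul, ← app_mul, mul_pinv_eq_one hunit2, app_one]
    rw [one_div, eq_inv_smul_iff₀ two_ne_zero]
    exact h.symm
  have key : app Rᵀ (gradient (model f x Q R) 0 - app Qᵀ (gradient f x)) i
      = 2 * (f (x + col (Q * R) i) - f x) - 1 / 2 * (f (x + (2 : ℝ) • col (Q * R) i) - f x)
        - inner ℝ (gradient f x) (col (Q * R) i) := by
    rw [gradient_model, app_sub, app_sub, app_smul]
    simp only [simplexGrad, e1, e2]
    rw [← app_mul, ← Matrix.transpose_mul, PiLp.sub_apply, app_transpose_apply,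
      real_inner_comm]
    simp [delta, col_smul, app_smul, col_mul, app_zero]
  rw [key]
  refine (hf.abs_extrapolation_le x _).trans ?_
  gcongr
  exact hcol i

/-- The gradient in the subspace dominates the aligned part of the gradient. -/
theorem norm_app_transpose_le (g : E n) {D Q : Matrix (Fin n) (Fin p) ℝ}
    {R : Matrix (Fin p) (Fin p) ℝ} (hqr : IsQR D Q R) {r : ℝ} (hr : 0 ≤ r)
    (hcol : ∀ i, ‖col D i‖ ≤ r) : ‖app Dᵀ g‖ ≤ √p * r * ‖app Qᵀ g‖ := by
  obtain ⟨hQ, -, rfl⟩ := hqr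
  rw [mul_assoc]
  refine norm_le_sqrt_mul (by positivity) fun i => ?_
  rw [Matrix.transpose_mul, app_mul, app_transpose_apply]
  refine (abs_real_inner_le_norm _ _).trans ?_
  gcongr
  rw [← norm_app_of_transpose_mul_self hQ, ← col_mul]
  exact hcol i

end Model

/-! ### Geometry of the direction matrices -/

section Directions

variable {n p : ℕ}

theorem sigmaMin_mul_norm_le (l : List (E n)) (y : E l.length) :
    sigmaMin l * ‖y‖ ≤ ‖∑ j, y j • l.get j‖ := by
  rcases (norm_nonneg y).eq_or_lt with hy | hy
  · rw [← hy, mul_zero]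
    exact norm_nonneg _
  have h : sigmaMin l ≤ ‖∑ j, (‖y‖⁻¹ • y) j • l.get j‖ := by
    refine csInf_le ⟨0, ?_⟩ ⟨‖y‖⁻¹ • y, ?_, rfl⟩
    · rintro r ⟨z, -, rfl⟩
      exact norm_nonneg _
    · rw [norm_smul, norm_inv, norm_norm, inv_mul_cancel₀ hy.ne']
  have h2 : ∑ j, (‖y‖⁻¹ • y) j • l.get j = ‖y‖⁻¹ • ∑ j, y j • l.get j := by
    simp [Finset.smul_sum, smul_smul]
  rw [h2, norm_smul, norm_inv, norm_norm] at h
  calc sigmaMin l * ‖y‖ ≤ ‖y‖⁻¹ * ‖∑ j, y j • l.get j‖ * ‖y‖ := by gcongr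
    _ = _ := by field_simp

theorem norm_sq_sum_smul_of_pairwise {l : List (E n)} {Δ : ℝ} (hnorm : ∀ d ∈ l, ‖d‖ = Δ)
    (hl : l.Pairwise (fun d e => inner ℝ d e = 0)) (y : Fin l.length → ℝ) :
    ‖∑ j, y j • l.get j‖ ^ 2 = Δ ^ 2 * ∑ j, y j ^ 2 := by
  have horth : ∀ i j, i ≠ j → inner ℝ (l.get i) (l.get j) = 0 := fun i j hij => by
    rcases lt_or_gt_of_ne hij with h | h
    · exact List.pairwise_iff_get.1 hl i j h
    · rw [real_inner_comm]
      exact List.pairwise_iff_get.1 hl j i h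
  rw [← real_inner_self_eq_norm_sq, sum_inner, Finset.mul_sum]
  refine Finset.sum_congr rfl fun i _ => ?_
  rw [inner_sum, Finset.sum_eq_single i]
  · rw [real_inner_smul_left, real_inner_smul_right, real_inner_self_eq_norm_sq,
      hnorm _ (List.get_mem l i)]
    ring
  · intro j _ hj
    rw [real_inner_smul_left, real_inner_smul_right, horth i j hj.symm]
    simp
  · simp

/-- Pythagoras: the recycled and generated parts of the combination are orthogonal, the first
bounded below through `sigmaMin`, the second an orthogonal system of length Δ. -/
theorem bounded_below_of_append {v : Fin p → E n} {DU DR : List (E n)}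
    (hv : List.ofFn v = DU ++ DR) {ε Δ : ℝ} (hε : 0 < ε) (hΔ : 0 < Δ)
    (hU : DU = [] ∨ ε ≤ sigmaMin DU) (hnorm : ∀ d ∈ DR, ‖d‖ = Δ)
    (hR : DR.Pairwise (fun d e => inner ℝ d e = 0)) (horth : ∀ d ∈ DR, ∀ e ∈ DU, inner ℝ d e = 0)
    (y : E p) : min ε Δ * ‖y‖ ≤ ‖∑ j, y j • v j‖ := by
  obtain rfl : p = DU.length + DR.length := by
    simpa using congrArg List.length hv
  obtain rfl : v = Fin.append DU.get DR.get := by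
    apply List.ofFn_injective
    rw [hv, List.ofFn_fin_append, List.ofFn_get, List.ofFn_get]
  set m := min ε Δ with hm
  have hm0 : 0 < m := lt_min hε hΔ
  set a := ∑ j, y (Fin.castAdd _ j) • DU.get j with ha
  set b := ∑ j, y (Fin.natAdd _ j) • DR.get j with hb
  have hsum : ∑ j, y j • Fin.append DU.get DR.get j = a + b := by
    rw [Fin.sum_univ_add]
    simp [ha, hb]
  have hab : inner ℝ a b = 0 := by
    rw [real_inner_comm, hb, sum_inner]
    refine Finset.sum_eq_zero fun i _ => ?_
    rw [ha, inner_sum]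
    refine Finset.sum_eq_zero fun j _ => ?_
    rw [real_inner_smul_left, real_inner_smul_right,
      horth _ (List.get_mem DR i) _ (List.get_mem DU j)]
    simp
  have h1 : m ^ 2 * ∑ j, y (Fin.castAdd DR.length j) ^ 2 ≤ ‖a‖ ^ 2 := by
    -- The empty list needs its own case: there `sigmaMin` is the infimum of the empty set, that is
    -- 0, and carries no information.
    rcases hU with hU | hU
    · have : IsEmpty (Fin DU.length) := by
        rw [hU]
        exact Fin.isEmpty
      simp only [Finset.univ_eq_empty, Finset.sum_empty, mul_zero]
      positivity
    · have h := sigmaMin_mul_norm_le DU (WithLp.toLp 2 fun j => y (Fin.castAdd _ j))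
      have h' : m * ‖(WithLp.toLp 2 fun j => y (Fin.castAdd DR.length j) : E DU.length)‖ ≤ ‖a‖ :=
        (mul_le_mul_of_nonneg_right ((min_le_left _ _).trans hU) (norm_nonneg _)).trans h
      have h2 := pow_le_pow_left₀ (by positivity) h' 2
      rwa [mul_pow, EuclideanSpace.real_norm_sq_eq] at h2
  have h2 : m ^ 2 * ∑ j, y (Fin.natAdd DU.length j) ^ 2 ≤ ‖b‖ ^ 2 := by
    rw [hb, norm_sq_sum_smul_of_pairwise hnorm hR fun j => y (Fin.natAdd _ j)]
    gcongr
    exact min_le_right _ _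
  refine (sq_le_sq₀ (by positivity) (norm_nonneg _)).1 ?_
  rw [hsum, norm_add_sq_real, hab, mul_pow, EuclideanSpace.real_norm_sq_eq, Fin.sum_univ_add,
    mul_add]
  linarith

theorem RemoveOne.subset {Δ : ℝ} {l l' : List (E n)} (h : RemoveOne Δ l l') : l' ⊆ l := by
  obtain ⟨i, -, rfl⟩ := h
  exact List.eraseIdx_subset

theorem Prune.subset {Δ ε : ℝ} {l l' : List (E n)} (h : Prune Δ ε l l') : l' ⊆ l := by
  induction h with
  | done => exact List.Subset.refl _
  | step _ _ h _ ih => exact List.Subset.trans ih h.subset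

theorem Prune.eq_nil_or_le {Δ ε : ℝ} {l l' : List (E n)} (h : Prune Δ ε l l') :
    l' = [] ∨ ε ≤ sigmaMin l' := by
  induction h with
  | done h => exact h
  | step _ _ _ _ ih => exact ih

theorem CreateDU.norm_le {P : Params n p} {x x' s : E n} {D : Matrix (Fin n) (Fin p) ℝ} {Δ : ℝ}
    {l : List (E n)} (h : CreateDU P x x' s D Δ l) {d : E n} (hd : d ∈ l) :
    ‖d‖ ≤ P.εrad * Δ := by
  obtain ⟨l₀, l₁, -, -, -, h⟩ := h
  simpa using (List.mem_filter.1 (h.subset hd)).2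

theorem CreateDU.eq_nil_or_le {P : Params n p} {x x' s : E n} {D : Matrix (Fin n) (Fin p) ℝ}
    {Δ : ℝ} {l : List (E n)} (h : CreateDU P x x' s D Δ l) : l = [] ∨ P.εgeo ≤ sigmaMin l := by
  obtain ⟨l₀, l₁, -, -, -, h⟩ := h
  exact h.eq_nil_or_le

end Directions

/-! ### Constants -/

namespace Params

variable {n p : ℕ} (P : Params n p)

theorem εrad_pos : 0 < P.εrad := zero_lt_one.trans_le P.one_le_εrad

theorem Δ0_pos : 0 < P.Δ0 := P.Δmin_pos.trans_le P.Δmin_le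

theorem Δmax_pos : 0 < P.Δmax := P.Δ0_pos.trans_le P.le_Δmax

theorem MR_pos : 0 < P.MR := by
  have := P.εgeo_pos
  have := P.εrad_pos
  have := P.Δmax_pos
  unfold MR
  positivity

theorem MD_pos : 0 < P.MD := by
  have := P.εrad_pos
  have := P.Δmax_pos
  unfold MD
  positivity

theorem κeg_nonneg (L : ℝ≥0) : 0 ≤ P.κeg L := by
  have := P.MR_pos
  unfold κeg
  positivity

theorem κlin_nonneg (L : ℝ≥0) : 0 ≤ P.κlin L :=
  mul_nonneg (P.κeg_nonneg L) (zero_le_one.trans (le_max_left _ _))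

/-- The model error is quadratic in the radius and becomes linear by bounding one factor by `Δmax`.
The second entry of the maximum in `κlin` is exactly what this costs. -/
theorem le_κlin (L : ℝ≥0) : √p * L * P.MR * P.εrad ^ 2 * P.Δmax ≤ P.κlin L := by
  have h := P.MR_pos
  have h3 : (0 : ℝ) < 3 * (2 * p * P.MR ^ 2 + 1) := by positivity
  calc √p * L * P.MR * P.εrad ^ 2 * P.Δmax
      = P.κeg L * (P.Δmax / (3 * (2 * p * P.MR ^ 2 + 1))) := by
        unfold κeg
        field_simp
    _ ≤ P.κlin L := mul_le_mul_of_nonneg_left (le_max_right _ _) (P.κeg_nonneg L)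

theorem εg_pos (L : ℝ≥0) {α ε : ℝ} (hα : 0 < α) (hε : 0 < ε) : 0 < P.εg L α ε := by
  have := P.MD_pos
  have := P.κlin_nonneg L
  have := P.mu_pos
  unfold εg
  positivity

theorem log_γdec_neg : Real.log P.γdec < 0 := Real.log_neg P.γdec_pos P.γdec_lt

theorem log_γinc_pos : 0 < Real.log P.γinc := Real.log_pos P.γinc_gt

theorem C1_eq : P.C1 = Real.log P.γinc / -Real.log P.γdec := by
  rw [C1, one_div, Real.log_inv, div_eq_inv_mul]

theorem C2_eq : P.C2 = (Real.log P.Δ0 - Real.log P.Δmin) / -Real.log P.γdec := by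
  rw [C2, Real.log_div P.Δ0_pos.ne' P.Δmin_pos.ne', one_div, Real.log_inv, inv_mul_eq_div]

theorem C1_pos : 0 < P.C1 := by
  rw [C1_eq]
  exact div_pos P.log_γinc_pos (neg_pos.2 P.log_γdec_neg)

theorem C2_nonneg : 0 ≤ P.C2 := by
  rw [C2_eq]
  exact div_nonneg (sub_nonneg.2 (Real.log_le_log P.Δmin_pos P.Δmin_le))
    (neg_pos.2 P.log_γdec_neg).le

/-- The bound min(ε_geo, Δ) for a fresh matrix is weakened to one proportional to Δ, because only a
proportional bound survives when a critical iteration scales D and Δ together. -/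
theorem scale_le_min {Δ : ℝ} (hΔ : 0 < Δ) (hΔ' : Δ ≤ P.Δmax) :
    P.εrad * Δ / P.MR ≤ min P.εgeo Δ := by
  have h1 := P.εgeo_pos
  have h2 := P.εrad_pos
  have h3 := P.Δmax_pos
  have h4 := P.Δmin_pos
  rw [div_le_iff₀ P.MR_pos]
  refine (min_mul_of_nonneg _ _ P.MR_pos.le).symm ▸ le_min ?_ ?_
  · calc P.εrad * Δ ≤ P.εrad * P.Δmax := by gcongr
      _ = P.εgeo * (1 / P.εgeo * P.εrad * P.Δmax) := by field_simp
      _ ≤ _ := by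
        unfold MR
        gcongr
        exact le_max_left _ _
  · calc P.εrad * Δ = Δ * (1 / P.Δmin * P.εrad * P.Δmin) := by field_simp
      _ ≤ Δ * (1 / P.Δmin * P.εrad * P.Δmax) := by
        gcongr
        exact P.Δmin_le.trans P.le_Δmax
      _ ≤ _ := by
        unfold MR
        gcongr
        exact le_max_right _ _

end Params

/-! ### Runs of the algorithm -/

namespace Trace

variable {n p : ℕ} {T : Trace n p} {f : E n → ℝ} {P : Params n p}

theorem reached_zero : T.Reached P 0 := fun _ h => absurd h (Nat.not_lt_zero _)

theorem reached_succ {k : ℕ} : T.Reached P (k + 1) ↔ T.Reached P k ∧ ¬ T.StopsAt P k := by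
  unfold Reached
  exact ⟨fun h => ⟨fun j hj => h j (hj.trans k.lt_succ_self), h k k.lt_succ_self⟩,
    fun h j hj => (Nat.lt_succ_iff_lt_or_eq.1 hj).elim (h.1 j) fun e => e ▸ h.2⟩

theorem Reached.mono {j k : ℕ} (h : T.Reached P k) (hjk : j ≤ k) : T.Reached P j :=
  fun i hi => h i (hi.trans_le hjk)

theorem Assembled.geometry {k : ℕ} {DU : List (E n)} (h : T.Assembled P k DU)
    (hΔ : 0 < T.Δ k) (hΔ' : T.Δ k ≤ P.Δmax) (hU : DU = [] ∨ P.εgeo ≤ sigmaMin DU)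
    (hU' : ∀ d ∈ DU, ‖d‖ ≤ P.εrad * T.Δ k) :
    (∀ i, ‖col (T.D k) i‖ ≤ P.εrad * T.Δ k) ∧
      ∀ y, P.εrad * T.Δ k / P.MR * ‖y‖ ≤ ‖app (T.D k) y‖ := by
  obtain ⟨-, DR, hcols, -, -, -, hnorm, hpair, horth⟩ := h
  refine ⟨fun i => ?_, fun y => ?_⟩
  · have hi : col (T.D k) i ∈ DU ++ DR := hcols ▸ (List.mem_ofFn.2 ⟨i, rfl⟩)
    rcases List.mem_append.1 hi with hi | hi
    · exact hU' _ hi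
    · rw [hnorm _ hi]
      exact le_mul_of_one_le_left hΔ.le P.one_le_εrad
  · rw [app_eq_sum_smul_col]
    exact (mul_le_mul_of_nonneg_right (P.scale_le_min hΔ hΔ') (norm_nonneg _)).trans
      (bounded_below_of_append hcols P.εgeo_pos hΔ hU hnorm hpair horth y)

/-- The radius decreases in iteration `k`. -/
def Decreasing (T : Trace n p) (f : E n → ℝ) (P : Params n p) (k : ℕ) : Prop :=
  T.Critical f P k ∨ T.rho f k < P.η1

namespace IsRun

variable (h : T.IsRun f P) {k : ℕ}
include h

theorem Δmin_le (hk : T.Reached P k) : P.Δmin ≤ T.Δ k := by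
  cases k with
  | zero => exact h.Δ_zero ▸ P.Δmin_le
  | succ k => exact not_lt.1 (reached_succ.1 hk).2

theorem Δ_pos (hk : T.Reached P k) : 0 < T.Δ k := P.Δmin_pos.trans_le (h.Δmin_le hk)

theorem Δ_succ_of_decreasing (hk : T.Reached P k) (hd : T.Decreasing f P k) :
    T.Δ (k + 1) = P.γdec * T.Δ k := by
  by_cases hc : T.Critical f P k
  · exact ((h.iteration k hk).critical hc).1
  · rw [(h.iteration k hk).radius hc, newRadius, if_pos (hd.resolve_left hc)]

theorem Δ_succ_of_not_decreasing (hk : T.Reached P k) (hd : ¬ T.Decreasing f P k) :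
    T.Δ (k + 1) = min (P.γinc * T.Δ k) P.Δmax ∨ T.Δ (k + 1) = T.Δ k := by
  obtain ⟨hc, hρ⟩ := not_or.1 hd
  rw [(h.iteration k hk).radius hc, newRadius, if_neg hρ]
  split_ifs
  · exact Or.inl rfl
  · exact Or.inr rfl

theorem Δ_le (hk : T.Reached P k) : T.Δ k ≤ P.Δmax := by
  induction k with
  | zero => exact h.Δ_zero ▸ P.le_Δmax
  | succ k ih =>
    have hk' := (reached_succ.1 hk).1
    by_cases hd : T.Decreasing f P k
    · rw [h.Δ_succ_of_decreasing hk' hd]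
      exact (mul_le_of_le_one_left (h.Δ_pos hk').le P.γdec_lt.le).trans (ih hk')
    · rcases h.Δ_succ_of_not_decreasing hk' hd with e | e
      · exact e ▸ min_le_right _ _
      · exact e ▸ ih hk'

open Classical in
-- Decreasing iterations multiply the radius by exactly `γdec`; all others multiply it by at most
-- `γinc`, the cap at `Δmax` only helping.
theorem log_Δ_le (hk : T.Reached P k) :
    Real.log (T.Δ k) ≤ Real.log P.Δ0 + ∑ j ∈ Finset.range k,
      (if T.Decreasing f P j then Real.log P.γdec else Real.log P.γinc) := by
  induction k with
  | zero => simp [h.Δ_zero]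
  | succ k ih =>
    have hk' := (reached_succ.1 hk).1
    have hpos := h.Δ_pos hk'
    have ih := ih hk'
    rw [Finset.sum_range_succ]
    split_ifs with hd
    · rw [h.Δ_succ_of_decreasing hk' hd, Real.log_mul P.γdec_pos.ne' hpos.ne']
      linarith
    · have hle : T.Δ (k + 1) ≤ P.γinc * T.Δ k := by
        rcases h.Δ_succ_of_not_decreasing hk' hd with e | e
        · exact e ▸ min_le_left _ _
        · rw [e]
          exact le_mul_of_one_le_left hpos.le P.γinc_gt.le
      have h1 := Real.log_le_log (h.Δ_pos hk) hle
      rw [Real.log_mul (zero_lt_one.trans P.γinc_gt).ne' hpos.ne'] at h1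
      linarith

open Classical in
/-- The number of iterations in which the radius decreases. -/
theorem sum_decreasing_le (hk : T.Reached P k) :
    ∑ j ∈ Finset.range k, (if T.Decreasing f P j then (1 : ℝ) else 0)
      ≤ P.C1 / (P.C1 + 1) * k + P.C2 / (P.C1 + 1) := by
  have h1 := h.log_Δ_le hk
  have h2 := Real.log_le_log P.Δmin_pos (h.Δmin_le hk)
  set N := ∑ j ∈ Finset.range k, (if T.Decreasing f P j then (1 : ℝ) else 0) with hN
  have h3 : ∑ j ∈ Finset.range k,
      (if T.Decreasing f P j then Real.log P.γdec else Real.log P.γinc)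
        = k * Real.log P.γinc - N * (Real.log P.γinc - Real.log P.γdec) := by
    rw [hN, Finset.sum_mul, ← nsmul_eq_mul, ← Finset.card_range k, ← Finset.sum_const,
      Finset.card_range, ← Finset.sum_sub_distrib]
    refine Finset.sum_congr rfl fun j _ => ?_
    split_ifs <;> ring
  have hd := P.log_γdec_neg
  have hi := P.log_γinc_pos
  have hs : 0 < Real.log P.γinc - Real.log P.γdec := by linarith
  rw [← mul_div_right_comm, ← add_div, le_div_iff₀ (by have := P.C1_pos; linarith), P.C1_eq,
    P.C2_eq]
  have hd' : 0 < -Real.log P.γdec := neg_pos.2 hd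
  -- This identity for C₁ + 1 reduces the claim to N(ln γ_inc - ln γ_dec) ≤ k ln γ_inc + ln Δ₀ - ln
  -- Δ_min, which is `h1` combined with `h2`.
  have e1 : Real.log P.γinc / -Real.log P.γdec + 1
      = (Real.log P.γinc - Real.log P.γdec) / -Real.log P.γdec := by
    rw [eq_div_iff hd'.ne', add_mul, div_mul_cancel₀ _ hd'.ne']
    ring
  rw [e1, div_mul_eq_mul_div, ← add_div, mul_div_assoc', div_le_div_iff_of_pos_right hd']
  linarith

/-- Every direction matrix has columns of length at most `ε_rad Δ`, and is bounded below at the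
same scale. -/
theorem geometry (hk : T.Reached P k) :
    (∀ i, ‖col (T.D k) i‖ ≤ P.εrad * T.Δ k) ∧
      ∀ y, P.εrad * T.Δ k / P.MR * ‖y‖ ≤ ‖app (T.D k) y‖ := by
  induction k with
  | zero => exact h.D_zero.geometry (h.Δ_pos hk) (h.Δ_le hk) (Or.inl rfl) (by simp)
  | succ k ih =>
    have hk' := (reached_succ.1 hk).1
    by_cases hc : T.Critical f P k
    -- A critical iteration scales D and Δ by the same factor, and both bounds are homogeneous in
    -- it.
    · obtain ⟨ih1, ih2⟩ := ih hk'
      obtain ⟨e1, -, e3⟩ := (h.iteration k hk').critical hc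
      have hγ := P.γdec_pos
      rw [e1, e3]
      refine ⟨fun i => ?_, fun y => ?_⟩
      · rw [col_smul, norm_smul, Real.norm_of_nonneg hγ.le]
        calc P.γdec * ‖col (T.D k) i‖ ≤ P.γdec * (P.εrad * T.Δ k) := by
              gcongr
              exact ih1 i
          _ = _ := by ring
      · rw [smul_app, norm_smul, Real.norm_of_nonneg hγ.le]
        calc P.εrad * (P.γdec * T.Δ k) / P.MR * ‖y‖
            = P.γdec * (P.εrad * T.Δ k / P.MR * ‖y‖) := by ring
          _ ≤ _ := by
            gcongr
            exact ih2 y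
    · obtain ⟨DU, hDU, hA⟩ := (h.iteration k hk').directions hc
      exact hA.geometry (h.Δ_pos hk) (h.Δ_le hk) hDU.eq_nil_or_le fun d hd => hDU.norm_le hd

/-- The ratio of the column bound ε_rad Δ to the lower bound of D is `MR`, so the columnwise cubic
error becomes √p L `MR` ε_rad² Δ². -/
theorem norm_gradient_mhat_sub_le {L : ℝ≥0} (hf : Smooth2Plus f L) (hk : T.Reached P k) :
    ‖gradient (T.mhat f k) 0 - app (T.Q k)ᵀ (gradient f (T.x k))‖ ≤ P.κlin L * T.Δ k := by
  obtain ⟨h1, h2⟩ := h.geometry hk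
  have hΔ := h.Δ_pos hk
  have hΔ' := h.Δ_le hk
  have hrad := P.εrad_pos
  have hMR := P.MR_pos
  have hr : 0 < P.εrad * T.Δ k := by positivity
  have h3 := norm_gradient_model_sub_le hf (T.x k) (h.iteration k hk).qr (div_pos hr hMR) hr.le h2 h1
  have h4 : ‖gradient (T.mhat f k) 0 - app (T.Q k)ᵀ (gradient f (T.x k))‖
      ≤ √p * L * P.MR * P.εrad ^ 2 * T.Δ k * T.Δ k := by
    refine le_of_mul_le_mul_left (h3.trans_eq ?_) (div_pos hr hMR)
    field_simp
  refine h4.trans ?_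
  gcongr
  refine le_trans ?_ (P.le_κlin L)
  gcongr

end IsRun

/-- Up to the scaling by critical iterations, the direction matrix is well aligned. -/
def Good (T : Trace n p) (f : E n → ℝ) (P : Params n p) (α : ℝ) (k : ℕ) : Prop :=
  ∃ c : ℝ, 0 ≤ c ∧ c * T.Δ k ≤ P.Δmax ∧
    α * ‖gradient f (T.x k)‖ ≤ c * ‖app (T.D k)ᵀ (gradient f (T.x k))‖

namespace IsRun

variable (h : T.IsRun f P) {k : ℕ} {α : ℝ}
include h

theorem good_of_wellAligned (hk : T.Reached P k) (ha : WellAligned α f (T.x k) (T.D k)) :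
    T.Good f P α k :=
  ⟨1, zero_le_one, by simpa using h.Δ_le hk, by simpa [WellAligned] using ha⟩

/-- The iterate is unchanged while D and Δ shrink by γ_dec. Replacing c by c/γ_dec restores the
alignment and leaves cΔ unchanged, which is why `Good` bounds that product instead of c. -/
theorem good_succ (hk : T.Reached P k) (hc : T.Critical f P k) (hg : T.Good f P α k) :
    T.Good f P α (k + 1) := by
  obtain ⟨c, hc0, hcΔ, hca⟩ := hg
  obtain ⟨e1, e2, e3⟩ := (h.iteration k hk).critical hc
  have hγ := P.γdec_pos
  refine ⟨c / P.γdec, by positivity, ?_, ?_⟩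
  · rw [e1]
    refine le_trans (le_of_eq ?_) hcΔ
    field_simp
  · rw [e2, e3, Matrix.transpose_smul, smul_app, norm_smul, Real.norm_of_nonneg hγ.le]
    refine hca.trans (le_of_eq ?_)
    field_simp

/-- Alignment bounds αε by `MD` times the projected gradient. Failure of the criticality test gives
Δ ≤ μ‖∇m̂‖, so the model error κΔ is absorbed and the projected gradient is at most (κμ + 1)‖∇m̂‖.
-/
theorem εg_le_norm_gradient_mhat {L : ℝ≥0} (hf : Smooth2Plus f L) (hk : T.Reached P k)
    (hc : ¬ T.Critical f P k) (hα : 0 < α) (hg : T.Good f P α k) {ε : ℝ}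
    (hε : ε ≤ ‖gradient f (T.x k)‖) : P.εg L α ε ≤ ‖gradient (T.mhat f k) 0‖ := by
  obtain ⟨c, hc0, hcΔ, hca⟩ := hg
  have hΔ := h.Δ_pos hk
  have hrad := P.εrad_pos
  have hMD := P.MD_pos
  have hκ := P.κlin_nonneg L
  have hmu := P.mu_pos
  have h1 := norm_app_transpose_le (gradient f (T.x k)) (h.iteration k hk).qr
    (by positivity : 0 ≤ P.εrad * T.Δ k) (h.geometry hk).1
  have h2 := h.norm_gradient_mhat_sub_le hf hk
  set g := gradient f (T.x k)
  set w := app (T.Q k)ᵀ g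
  set v := gradient (T.mhat f k) 0 with hv
  have h3 : T.Δ k ≤ P.mu * ‖v‖ := not_lt.1 hc
  have h4 : ‖w‖ ≤ (P.κlin L * P.mu + 1) * ‖v‖ := by
    have h5 : ‖w‖ ≤ ‖v‖ + ‖v - w‖ := by
      rw [← norm_neg (v - w)]
      calc ‖w‖ = ‖v + -(v - w)‖ := by congr 1; abel
        _ ≤ _ := norm_add_le _ _
    have h6 : P.κlin L * T.Δ k ≤ P.κlin L * (P.mu * ‖v‖) := by gcongr
    linarith
  unfold Params.εg
  rw [div_le_iff₀ (by positivity)]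
  calc α * ε ≤ α * ‖g‖ := by gcongr
    _ ≤ c * ‖app (T.D k)ᵀ g‖ := hca
    _ ≤ c * (√p * (P.εrad * T.Δ k) * ‖w‖) := by gcongr
    _ = P.εrad * (c * T.Δ k) * √p * ‖w‖ := by ring
    _ ≤ P.εrad * P.Δmax * √p * ‖w‖ := by gcongr
    _ ≤ P.MD * ‖w‖ := by
      gcongr
      unfold Params.MD
      linarith [P.Δmax_pos]
    _ ≤ P.MD * ((P.κlin L * P.mu + 1) * ‖v‖) := by gcongr
    _ = _ := by ring

theorem f_succ_le (hk : T.Reached P k) : f (T.x (k + 1)) ≤ f (T.x k) := by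
  by_cases hc : T.Critical f P k
  · rw [((h.iteration k hk).critical hc).2.1]
  · simpa using (h.iteration k hk).next_le_sample hc 0 (by simp) 0 (by simp)

variable {L : ℝ≥0} (hf : Smooth2Plus f L) {κH : ℝ} (hκH : 1 ≤ κH)
  (hHess : ∀ k, T.Reached P k → ‖hess (T.mhat f k) 0‖ ≤ κH) {c₁ : ℝ} (hc₁ : 0 < c₁)
  (hCauchy : ∀ k, T.Reached P k → ¬ T.Critical f P k →
    c₁ * ‖gradient (T.mhat f k) 0‖ *
        min (T.Δ k) (‖gradient (T.mhat f k) 0‖ / max ‖hess (T.mhat f k) 0‖ 1)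
      ≤ T.mhat f k 0 - T.mhat f k (T.s k))
  (hα : 0 < α)
include hf hκH hHess hc₁ hCauchy hα

theorem decrease_of_good {ε : ℝ} (hε : 0 < ε) (hk : T.Reached P k)
    (hd : ¬ T.Decreasing f P k) (hg : T.Good f P α k) (hgrad : ε ≤ ‖gradient f (T.x k)‖) :
    P.η1 * c₁ * P.εg L α ε * min (P.εg L α ε / κH) P.Δmin ≤ f (T.x k) - f (T.x (k + 1)) := by
  obtain ⟨hc, hρ⟩ := not_or.1 hd
  have h1 := h.εg_le_norm_gradient_mhat hf hk hc hα hg hgrad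
  have h2 := hCauchy k hk hc
  have h3 := hHess k hk
  have hη := P.η1_pos
  have he := P.εg_pos L hα hε
  set v := ‖gradient (T.mhat f k) 0‖
  set e := P.εg L α ε
  have h4 : c₁ * e * min (e / κH) P.Δmin ≤ T.mhat f k 0 - T.mhat f k (T.s k) := by
    refine le_trans ?_ h2
    have hpos : 0 < max ‖hess (T.mhat f k) 0‖ 1 := zero_lt_one.trans_le (le_max_right _ _)
    have : 0 ≤ min (e / κH) P.Δmin := le_min (by positivity) P.Δmin_pos.le
    gcongr c₁ * ?_ * ?_
    rw [min_comm]
    refine min_le_min (h.Δmin_le hk) ?_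
    gcongr
    exact max_le h3 hκH
  -- The predicted decrease is positive, so the denominator of ρ may be cleared in ρ ≥ η₁.
  have h5 : 0 < c₁ * e * min (e / κH) P.Δmin := by
    have := P.Δmin_pos
    positivity
  have h6 : P.η1 * (T.mhat f k 0 - T.mhat f k (T.s k))
      ≤ f (T.x k) - f (T.x k + T.fullStep k) :=
    (le_div_iff₀ (h5.trans_le h4)).1 (not_lt.1 hρ)
  have h7 := (h.iteration k hk).next_le_step hc
  calc P.η1 * c₁ * e * min (e / κH) P.Δmin = P.η1 * (c₁ * e * min (e / κH) P.Δmin) := by ring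
    _ ≤ P.η1 * (T.mhat f k 0 - T.mhat f k (T.s k)) := by gcongr
    _ ≤ _ := by linarith

open Classical in
-- Telescoping: f never increases, drops by a fixed amount in each counted iteration, and stays
-- above `flow`.
theorem sum_good_le {flow : ℝ} (hbelow : ∀ x, flow ≤ f x) {ε : ℝ} (hε : 0 < ε)
    (hk : T.Reached P k) (hgrad : ∀ j < k, ε ≤ ‖gradient f (T.x j)‖) :
    ∑ j ∈ Finset.range k, (if ¬ T.Decreasing f P j ∧ T.Good f P α j then (1 : ℝ) else 0)
      ≤ P.phi L α (f P.x0 - flow) κH c₁ ε := by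
  have hpos : 0 < P.η1 * c₁ * P.εg L α ε * min (P.εg L α ε / κH) P.Δmin := by
    have := P.η1_pos
    have := P.εg_pos L hα hε
    have := P.Δmin_pos
    positivity
  rw [Params.phi, le_div_iff₀ hpos]
  have key : (∑ j ∈ Finset.range k, (if ¬ T.Decreasing f P j ∧ T.Good f P α j then (1 : ℝ) else 0))
      * (P.η1 * c₁ * P.εg L α ε * min (P.εg L α ε / κH) P.Δmin) ≤ f P.x0 - f (T.x k) := by
    induction k with
    | zero => simp [h.x_zero]
    | succ k ih =>
      have hk' := (reached_succ.1 hk).1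
      have ih := ih hk' fun j hj => hgrad j (hj.trans k.lt_succ_self)
      have hmono := h.f_succ_le hk'
      rw [Finset.sum_range_succ, add_mul]
      split_ifs with hg
      · have := h.decrease_of_good hf hκH hHess hc₁ hCauchy hα hε hk' hg.1 hg.2
          (hgrad k k.lt_succ_self)
        linarith
      · linarith
  linarith [hbelow (T.x k)]

end IsRun

/-- If directions are sampled for iteration `k`, they are well aligned. -/
def AlignedIfFresh (T : Trace n p) (f : E n → ℝ) (P : Params n p) (α : ℝ) (k : ℕ) : Prop :=
  T.Fresh f P k → WellAligned α f (T.x k) (T.D k)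

open Classical in
-- A vacuous success in a non-good iteration is charged to its predecessor, which is critical and
-- also not good. The extra term on the left is that charge carried forward: it is created by a
-- critical non-good iteration and spent in the next one, which makes the induction close.
theorem IsRun.sum_alignedIfFresh_le_sum (h : T.IsRun f P) {α : ℝ} {k : ℕ} (hk : T.Reached P k) :
    ∑ j ∈ Finset.range k, (if T.AlignedIfFresh f P α j then (1 : ℝ) else 0)
      + (if ¬ T.Fresh f P k ∧ ∃ j, k = j + 1 ∧ ¬ T.Good f P α j then 1 else 0)
      ≤ ∑ j ∈ Finset.range k, (if T.Decreasing f P j ∨ T.Good f P α j then (1 : ℝ) else 0) := by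
  induction k with
  | zero => simp
  | succ k ih =>
    have hk' := (reached_succ.1 hk).1
    have ih := ih hk'
    rw [Finset.sum_range_succ, Finset.sum_range_succ]
    have hfresh : T.Fresh f P (k + 1) ↔ ¬ T.Critical f P k := by
      simp [Fresh, hk']
    have hpend : (¬ T.Fresh f P (k + 1) ∧ ∃ j, k + 1 = j + 1 ∧ ¬ T.Good f P α j)
        ↔ T.Critical f P k ∧ ¬ T.Good f P α k := by
      simp [hfresh]
    rw [if_congr hpend rfl rfl]
    have hcd : T.Critical f P k → T.Decreasing f P k := Or.inl
    by_cases hF : T.Fresh f P k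
    · have hal : T.AlignedIfFresh f P α k → T.Good f P α k :=
        fun ha => h.good_of_wellAligned hk' (ha hF)
      rw [if_neg fun hn => hn.1 hF] at ih
      by_cases hg : T.Good f P α k
      · rw [if_neg (c := T.Critical f P k ∧ ¬ T.Good f P α k) fun hn => hn.2 hg, if_pos (Or.inr hg)]
        have : (if T.AlignedIfFresh f P α k then (1 : ℝ) else 0) ≤ 1 := by split_ifs <;> norm_num
        linarith
      · rw [if_neg (mt hal hg)]
        have : (if T.Critical f P k ∧ ¬ T.Good f P α k then (1 : ℝ) else 0)
            ≤ if T.Decreasing f P k ∨ T.Good f P α k then 1 else 0 := by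
          by_cases hc : T.Critical f P k
          · rw [if_pos ⟨hc, hg⟩, if_pos (Or.inl (hcd hc))]
          · rw [if_neg fun hn => hc hn.1]
            split_ifs <;> norm_num
        linarith
    · have hZ : T.AlignedIfFresh f P α k := fun hF' => absurd hF' hF
      rw [if_pos hZ]
      obtain ⟨j, rfl⟩ := Nat.exists_eq_succ_of_ne_zero fun h0 => hF (Or.inl h0)
      have hj := (reached_succ.1 hk').1
      have hcj : T.Critical f P j := by
        by_contra hcj
        exact hF (Or.inr ⟨j, rfl, hj, hcj⟩)
      by_cases hg : T.Good f P α (j + 1)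
      · rw [if_neg (c := T.Critical f P (j + 1) ∧ ¬ T.Good f P α (j + 1)) fun hn => hn.2 hg,
          if_pos (Or.inr hg)]
        have : (0 : ℝ) ≤ if ¬ T.Fresh f P (j + 1) ∧ ∃ i, j + 1 = i + 1 ∧ ¬ T.Good f P α i
            then 1 else 0 := by split_ifs <;> norm_num
        linarith
      -- Goodness passes through critical iterations, so the predecessor was not good either and its
      -- charge pays for this vacuous success.
      · rw [if_pos ⟨hF, j, rfl, fun hgj => hg (h.good_succ hj hcj hgj)⟩] at ih
        have : (if T.Critical f P (j + 1) ∧ ¬ T.Good f P α (j + 1) then (1 : ℝ) else 0)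
            ≤ if T.Decreasing f P (j + 1) ∨ T.Good f P α (j + 1) then 1 else 0 := by
          by_cases hc : T.Critical f P (j + 1)
          · rw [if_pos ⟨hc, hg⟩, if_pos (Or.inl (hcd hc))]
          · rw [if_neg fun hn => hc hn.1]
            split_ifs <;> norm_num
        linarith

open Classical in
theorem IsRun.sum_alignedIfFresh_le (h : T.IsRun f P) {k : ℕ} {α : ℝ} {L : ℝ≥0}
    (hf : Smooth2Plus f L) {κH : ℝ} (hκH : 1 ≤ κH)
    (hHess : ∀ k, T.Reached P k → ‖hess (T.mhat f k) 0‖ ≤ κH) {c₁ : ℝ} (hc₁ : 0 < c₁)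
    (hCauchy : ∀ k, T.Reached P k → ¬ T.Critical f P k →
      c₁ * ‖gradient (T.mhat f k) 0‖ *
          min (T.Δ k) (‖gradient (T.mhat f k) 0‖ / max ‖hess (T.mhat f k) 0‖ 1)
        ≤ T.mhat f k 0 - T.mhat f k (T.s k))
    (hα : 0 < α) {flow : ℝ} (hbelow : ∀ x, flow ≤ f x) {ε : ℝ} (hε : 0 < ε)
    (hk : T.Reached P k) (hgrad : ∀ j < k, ε ≤ ‖gradient f (T.x j)‖) :
    ∑ j ∈ Finset.range k, (if T.AlignedIfFresh f P α j then (1 : ℝ) else 0)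
      ≤ P.psi L α (f P.x0 - flow) κH c₁ ε + P.C1 / (P.C1 + 1) * k := by
  have h1 := h.sum_alignedIfFresh_le_sum (α := α) hk
  have h2 := h.sum_good_le hf hκH hHess hc₁ hCauchy hα hbelow hε hk hgrad
  have h3 := h.sum_decreasing_le hk
  have h4 : ∑ j ∈ Finset.range k, (if T.Decreasing f P j ∨ T.Good f P α j then (1 : ℝ) else 0)
      ≤ ∑ j ∈ Finset.range k, (if T.Decreasing f P j then (1 : ℝ) else 0)
        + ∑ j ∈ Finset.range k,
          (if ¬ T.Decreasing f P j ∧ T.Good f P α j then (1 : ℝ) else 0) := by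
    rw [← Finset.sum_add_distrib]
    refine Finset.sum_le_sum fun j _ => ?_
    by_cases hd : T.Decreasing f P j <;> by_cases hg : T.Good f P α j <;> simp [hd, hg]
  have h5 : (0 : ℝ) ≤ if ¬ T.Fresh f P k ∧ ∃ j, k = j + 1 ∧ ¬ T.Good f P α j then 1 else 0 := by
    split_ifs <;> norm_num
  unfold Params.psi
  linarith

end Trace

/-! ### Probability estimates -/

section Paths

variable {n p : ℕ} {Ω : Type*} {f : E n → ℝ} {P : Params n p} {X : Ω → Trace n p}

/-- Iteration `k` is performed, and the gradient has always been larger than `ε`. -/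
def activeSet (f : E n → ℝ) (P : Params n p) (X : Ω → Trace n p) (ε : ℝ) (k : ℕ) : Set Ω :=
  {ω | (X ω).Reached P k ∧ ∀ j ≤ k, ε < ‖gradient f ((X ω).x j)‖}

/-- Iteration `k` is active and not the last one. -/
def survivalSet (f : E n → ℝ) (P : Params n p) (X : Ω → Trace n p) (ε : ℝ) (k : ℕ) : Set Ω :=
  activeSet f P X ε k ∩ {ω | ¬ (X ω).StopsAt P k}

theorem activeSet_succ_subset (ε : ℝ) (k : ℕ) :
    activeSet f P X ε (k + 1) ⊆ survivalSet f P X ε k := fun _ h =>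
  ⟨⟨(Trace.reached_succ.1 h.1).1, fun j hj => h.2 j (hj.trans k.le_succ)⟩,
    (Trace.reached_succ.1 h.1).2⟩

theorem survivalSet_antitone (ε : ℝ) : Antitone (survivalSet f P X ε) :=
  antitone_nat_of_succ_le fun k =>
    Set.inter_subset_left.trans (activeSet_succ_subset ε k)

open Classical in
/-- The survived iterations among the first `N` ones are an initial segment. -/
theorem exists_sum_survivalSet_eq (ω : Ω) (ε : ℝ) (N : ℕ) :
    ∃ M, (X ω).Reached P M ∧ (∀ j < M, ε < ‖gradient f ((X ω).x j)‖) ∧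
      (∀ g : ℕ → ℝ, ∑ k ∈ Finset.range N, (if ω ∈ survivalSet f P X ε k then g k else 0)
        = ∑ k ∈ Finset.range M, g k) ∧
      (M = N ∨ ω ∉ survivalSet f P X ε N) := by
  induction N with
  | zero => exact ⟨0, Trace.reached_zero, by simp, by simp, Or.inl rfl⟩
  | succ N ih =>
    obtain ⟨M, h1, h2, h3, h4⟩ := ih
    by_cases hN : ω ∈ survivalSet f P X ε N
    · obtain rfl := h4.resolve_right (not_not.2 hN)
      refine ⟨M + 1, Trace.reached_succ.2 ⟨h1, hN.2⟩, fun j hj => hN.1.2 j (by omega),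
        fun g => ?_, Or.inl rfl⟩
      rw [Finset.sum_range_succ, Finset.sum_range_succ, h3, if_pos hN]
    · refine ⟨M, h1, h2, fun g => ?_, Or.inr fun h => hN (survivalSet_antitone ε N.le_succ h)⟩
      rw [Finset.sum_range_succ, h3, if_neg hN, add_zero]

/-- Every index below both times is a survived iteration and contributes 1 to the series. -/
theorem toENNReal_min_le_tsum (ω : Ω) (ε : ℝ) :
    ((min ((X ω).hitting f ε) ((X ω).stopping P) : ℕ∞) : ℝ≥0∞)
      ≤ ∑' k, (survivalSet f P X ε k).indicator (1 : Ω → ℝ≥0∞) ω := by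
  set T := min ((X ω).hitting f ε) ((X ω).stopping P) with hT
  have key : ∀ k : ℕ, (k : ℕ∞) < T → ω ∈ survivalSet f P X ε k := by
    intro k hk
    have h1 : ∀ j ≤ k, ε < ‖gradient f ((X ω).x j)‖ := by
      intro j hj
      by_contra hcon
      have : (X ω).hitting f ε ≤ j := sInf_le ⟨j, not_lt.1 hcon, rfl⟩
      exact absurd ((hk.trans_le (min_le_left _ _)).trans_le this) (by simpa using hj)
    have h2 : ∀ j ≤ k, ¬ (X ω).StopsAt P j := by
      intro j hj hcon
      have : (X ω).stopping P ≤ j := sInf_le ⟨j, hcon, rfl⟩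
      exact absurd ((hk.trans_le (min_le_right _ _)).trans_le this) (by simpa using hj)
    exact ⟨⟨fun j hj => h2 j hj.le, h1⟩, h2 k le_rfl⟩
  have hN : ∀ N : ℕ, (N : ℕ∞) ≤ T →
      (N : ℝ≥0∞) ≤ ∑' k, (survivalSet f P X ε k).indicator (1 : Ω → ℝ≥0∞) ω := by
    intro N hNT
    refine le_trans (le_of_eq ?_) (ENNReal.sum_le_tsum (Finset.range N))
    rw [Finset.sum_congr rfl fun k hk => Set.indicator_of_mem (key k
      (lt_of_lt_of_le (by exact_mod_cast Finset.mem_range.1 hk) hNT)) _]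
    simp
  cases hTc : T with
  | top =>
    rw [hTc] at hN
    rw [ENat.toENNReal_top, top_le_iff]
    exact ENNReal.eq_top_of_forall_nnreal_le fun r => by
      obtain ⟨N, hrN⟩ := exists_nat_ge r
      exact le_trans (by exact_mod_cast hrN) (hN N le_top)
  | coe m => simpa using hN m hTc.ge

end Paths

/-! ### Measurability, and the passage from paths to expectations -/

section Probability

variable {n p : ℕ} {Ω : Type*} [mΩ : MeasurableSpace Ω] {μ : Measure Ω}
  {ℱ : Filtration ℕ mΩ} {f : E n → ℝ} {P : Params n p} {X : Ω → Trace n p}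

theorem IsRandomRun.measurableSet_stopsAt (hX : IsRandomRun μ ℱ f P X) (k : ℕ) :
    MeasurableSet[ℱ (k + 1)] {ω | (X ω).StopsAt P k} :=
  measurableSet_lt (hX.meas_Δ (k + 1)) measurable_const

theorem IsRandomRun.measurableSet_reached (hX : IsRandomRun μ ℱ f P X) (k : ℕ) :
    MeasurableSet[ℱ k] {ω | (X ω).Reached P k} := by
  induction k with
  | zero => simp [Trace.reached_zero]
  | succ k ih =>
    simp only [Trace.reached_succ]
    exact (ℱ.mono k.le_succ _ ih).inter (hX.measurableSet_stopsAt k).compl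

/-- Freshness of an iteration is settled by its predecessor, so it is known before sampling and the
conditional bound can be integrated over it. -/
theorem IsRandomRun.measurableSet_fresh (hX : IsRandomRun μ ℱ f P X) (k : ℕ) :
    MeasurableSet[ℱ k] {ω | (X ω).Fresh f P k} := by
  cases k with
  | zero => simp [Trace.Fresh]
  | succ k =>
    have : {ω | (X ω).Fresh f P (k + 1)}
        = {ω | (X ω).Reached P k} ∩ {ω | (X ω).Critical f P k}ᶜ := by
      ext ω
      simp [Trace.Fresh]
    rw [this]
    exact (ℱ.mono k.le_succ _ (hX.measurableSet_reached k)).inter (hX.meas_critical k).compl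

theorem IsRandomRun.measurable_gradient (hX : IsRandomRun μ ℱ f P X) {L : ℝ≥0}
    (hf : Smooth2Plus f L) (k : ℕ) : Measurable[ℱ k] fun ω => gradient f ((X ω).x k) :=
  hf.contDiff_gradient.continuous.measurable.comp (hX.meas_x k)

theorem IsRandomRun.measurableSet_activeSet (hX : IsRandomRun μ ℱ f P X) {L : ℝ≥0}
    (hf : Smooth2Plus f L) (ε : ℝ) (k : ℕ) : MeasurableSet[ℱ k] (activeSet f P X ε k) := by
  have h : activeSet f P X ε k = {ω | (X ω).Reached P k} ∩
      ⋂ j ∈ Set.Iic k, {ω | ε < ‖gradient f ((X ω).x j)‖} := by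
    ext ω
    simp [activeSet]
  rw [h]
  refine (hX.measurableSet_reached k).inter
    (MeasurableSet.biInter (Set.to_countable _) fun j hj => ℱ.mono hj _ ?_)
  have h := hX.measurable_gradient hf j
  exact (continuous_norm.measurable.comp h) measurableSet_Ioi

theorem IsRandomRun.measurableSet_survivalSet (hX : IsRandomRun μ ℱ f P X) {L : ℝ≥0}
    (hf : Smooth2Plus f L) (ε : ℝ) (k : ℕ) : MeasurableSet (survivalSet f P X ε k) :=
  (ℱ.le k _ (hX.measurableSet_activeSet hf ε k)).inter
    (ℱ.le (k + 1) _ (hX.measurableSet_stopsAt k)).compl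

theorem IsRandomRun.measurableSet_wellAligned (hX : IsRandomRun μ ℱ f P X) {L : ℝ≥0}
    (hf : Smooth2Plus f L) (α : ℝ) (k : ℕ) :
    MeasurableSet {ω | WellAligned α f ((X ω).x k) ((X ω).D k)} := by
  have hg : Measurable fun ω => gradient f ((X ω).x k) :=
    (hX.measurable_gradient hf k).mono (ℱ.le k) le_rfl
  have hgi : ∀ i, Measurable fun ω => gradient f ((X ω).x k) i := fun i =>
    (EuclideanSpace.proj i : E n →L[ℝ] ℝ).continuous.measurable.comp hg
  have hD : ∀ i j, Measurable fun ω => (X ω).D k i j := fun i j =>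
    (hX.meas_D k i j).mono (ℱ.le (k + 1)) le_rfl
  refine measurableSet_le (hg.norm.const_mul α) ?_
  simp_rw [EuclideanSpace.norm_eq, app_apply, Matrix.transpose_apply]
  refine Measurable.sqrt (Finset.measurable_fun_sum _ fun i _ => Measurable.pow_const ?_ 2)
  exact (Finset.measurable_fun_sum _ fun j _ => (hD j i).mul (hgi j)).norm

theorem IsRandomRun.measurableSet_alignedIfFresh (hX : IsRandomRun μ ℱ f P X) {L : ℝ≥0}
    (hf : Smooth2Plus f L) (α : ℝ) (k : ℕ) :
    MeasurableSet {ω | (X ω).AlignedIfFresh f P α k} := by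
  have h : {ω | (X ω).AlignedIfFresh f P α k}
      = {ω | (X ω).Fresh f P k}ᶜ ∪ {ω | WellAligned α f ((X ω).x k) ((X ω).D k)} := by
    ext ω
    simp [Trace.AlignedIfFresh, imp_iff_not_or]
  rw [h]
  exact (ℱ.le k _ (hX.measurableSet_fresh k)).compl.union (hX.measurableSet_wellAligned hf α k)

/-- A lower bound on a conditional probability gives a lower bound on joint probabilities. -/
theorem mul_measureReal_le_of_le_condExp [IsProbabilityMeasure μ] {m : MeasurableSpace Ω}
    (hm : m ≤ mΩ) {H S : Set Ω} (hH : MeasurableSet[m] H) (hS : MeasurableSet[mΩ] S) {q : ℝ}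
    (hq : ∀ᵐ ω ∂μ, ω ∈ H → q ≤ (μ⟦S | m⟧) ω) : q * μ.real H ≤ μ.real (H ∩ S) := by
  have h1 : ∫ ω in H, (μ⟦S | m⟧) ω ∂μ = μ.real (H ∩ S) := by
    rw [setIntegral_condExp hm ((integrable_const (1 : ℝ)).indicator hS) hH,
      setIntegral_indicator hS]
    simp
  have h2 : ∫ _ω in H, q ∂μ = q * μ.real H := by simp [mul_comm]
  rw [← h1, ← h2]
  exact setIntegral_mono_on_ae (integrable_const q).integrableOn integrable_condExp.integrableOn
    (hm _ hH) hq

/-- Split by freshness: on the fresh part the conditional bound is integrated, on the rest success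
is automatic. -/
theorem IsRandomRun.mul_measureReal_activeSet_le [IsProbabilityMeasure μ]
    (hX : IsRandomRun μ ℱ f P X) {L : ℝ≥0} (hf : Smooth2Plus f L) {α δ : ℝ} (hδ : 0 < δ)
    (hquality : SubspaceQuality μ ℱ f P X α δ) (ε : ℝ) (k : ℕ) :
    (1 - δ) * μ.real (activeSet f P X ε k)
      ≤ μ.real (activeSet f P X ε k ∩ {ω | (X ω).AlignedIfFresh f P α k}) := by
  set A := activeSet f P X ε k
  set F := {ω | (X ω).Fresh f P k}
  set S := {ω | WellAligned α f ((X ω).x k) ((X ω).D k)}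
  have hA := hX.measurableSet_activeSet hf ε k
  have hF := hX.measurableSet_fresh k
  have hS : MeasurableSet S := hX.measurableSet_wellAligned hf α k
  have h1 : (1 - δ) * μ.real (A ∩ F) ≤ μ.real (A ∩ F ∩ S) := by
    refine mul_measureReal_le_of_le_condExp (ℱ.le k) (hA.inter hF) hS ?_
    filter_upwards [hquality k] with ω hω h
    exact hω h.1.1 h.2
  have h2 : (1 - δ) * μ.real (A \ F) ≤ μ.real (A \ F) :=
    mul_le_of_le_one_left measureReal_nonneg (by linarith)
  have h3 := measureReal_inter_add_sdiff (μ := μ) (s := A) (ℱ.le k _ hF)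
  have h4 := measureReal_inter_add_sdiff (μ := μ)
    (s := A ∩ {ω | (X ω).AlignedIfFresh f P α k}) (ℱ.le k _ hF)
  have h5 : A ∩ {ω | (X ω).AlignedIfFresh f P α k} ∩ F = A ∩ F ∩ S := by
    ext ω
    simp only [Set.mem_inter_iff, Set.mem_ofPred_eq, Trace.AlignedIfFresh, F, S]
    tauto
  have h6 : (A ∩ {ω | (X ω).AlignedIfFresh f P α k}) \ F = A \ F := by
    ext ω
    simp only [Set.mem_inter_iff, Set.mem_sdiff, Set.mem_ofPred_eq, Trace.AlignedIfFresh, F]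
    tauto
  rw [← h4, h5, h6, ← h3]
  linarith

theorem integral_sum_indicator_one [IsProbabilityMeasure μ] {s : ℕ → Set Ω}
    (hs : ∀ k, MeasurableSet (s k)) (N : ℕ) :
    ∫ ω, ∑ k ∈ Finset.range N, (s k).indicator (1 : Ω → ℝ) ω ∂μ
      = ∑ k ∈ Finset.range N, μ.real (s k) := by
  have h := integral_finsetSum (μ := μ) (Finset.range N) (f := fun k => (s k).indicator (1 : Ω → ℝ))
    fun k _ => (integrable_const (1 : ℝ)).indicator (hs k)
  rw [h]
  exact Finset.sum_congr rfl fun k _ => integral_indicator_one (hs k)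

/-- Two families of events are needed. The conditional bound requires events known before sampling
(`activeSet`), whereas the pathwise count over the first M iterations requires that iteration M is
still reached, hence `survivalSet`. Passing between them costs only the δ in the numerator. -/
theorem IsRandomRun.sum_measureReal_survivalSet_le [IsProbabilityMeasure μ]
    (hX : IsRandomRun μ ℱ f P X) {L : ℝ≥0} (hf : Smooth2Plus f L) {flow : ℝ}
    (hbelow : ∀ x, flow ≤ f x) {κH : ℝ} (hκH : 1 ≤ κH) (hHess : ModelHessBound μ f P X κH)
    {c₁ : ℝ} (hc₁ : 0 < c₁) (hCauchy : CauchyDecrease μ f P X c₁) {α : ℝ} (hα : 0 < α) {δ : ℝ}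
    (hδ : 0 < δ) (hδ' : δ < 1 / (P.C1 + 1)) (hquality : SubspaceQuality μ ℱ f P X α δ) {ε : ℝ}
    (hε : 0 < ε) (N : ℕ) :
    ∑ k ∈ Finset.range N, μ.real (survivalSet f P X ε k)
      ≤ (P.psi L α (f P.x0 - flow) κH c₁ ε + δ) / (1 - δ - P.C1 / (P.C1 + 1)) := by
  set A := activeSet f P X ε
  set A' := survivalSet f P X ε
  set B := fun k => {ω | (X ω).AlignedIfFresh f P α k}
  have hA' : ∀ k, MeasurableSet (A' k) := hX.measurableSet_survivalSet hf ε
  have hB : ∀ k, MeasurableSet (B k) := hX.measurableSet_alignedIfFresh hf α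
  set a := P.C1 / (P.C1 + 1) with ha
  set ψ := P.psi L α (f P.x0 - flow) κH c₁ ε
  have hC1 := P.C1_pos
  have ha1 : 1 - a = 1 / (P.C1 + 1) := by
    rw [ha]
    field_simp
    ring
  have hpath : ∑ k ∈ Finset.range N, μ.real (A' k ∩ B k)
      ≤ ψ + a * ∑ k ∈ Finset.range N, μ.real (A' k) := by
    have hint : ∀ s : ℕ → Set Ω, (∀ k, MeasurableSet (s k)) →
        Integrable (fun ω => ∑ k ∈ Finset.range N, (s k).indicator (1 : Ω → ℝ) ω) μ :=
      fun s hs => integrable_finsetSum _ fun k _ => (integrable_const (1 : ℝ)).indicator (hs k)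
    rw [← integral_sum_indicator_one (fun k => (hA' k).inter (hB k)),
      ← integral_sum_indicator_one hA', ← integral_const_mul]
    have hψ : ψ = ∫ _ω, ψ ∂μ := by simp
    rw [hψ, ← integral_add (integrable_const _) ((hint _ hA').const_mul a)]
    refine integral_mono_ae (hint _ fun k => (hA' k).inter (hB k))
      ((integrable_const _).add ((hint _ hA').const_mul a)) ?_
    filter_upwards [hX.isRun, hHess, hCauchy] with ω h1 h2 h3
    classical
    obtain ⟨M, hM, hgrad, hsum, -⟩ := exists_sum_survivalSet_eq (f := f) (P := P) (X := X) ω ε N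
    have h4 := h1.sum_alignedIfFresh_le hf hκH h2 hc₁ h3 hα hbelow hε hM fun j hj => (hgrad j hj).le
    have e1 : ∑ k ∈ Finset.range N, (A' k ∩ B k).indicator (1 : Ω → ℝ) ω
        = ∑ k ∈ Finset.range M, (if (X ω).AlignedIfFresh f P α k then (1 : ℝ) else 0) := by
      rw [← hsum]
      refine Finset.sum_congr rfl fun k _ => ?_
      rw [← Set.indicator_indicator]
      simp [Set.indicator_apply, A', B]
    have e2 : ∑ k ∈ Finset.range N, (A' k).indicator (1 : Ω → ℝ) ω = M := by
      have := hsum 1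
      simpa [Set.indicator_apply, A'] using this
    simp only [e1, e2]
    exact h4
  have hq : (1 - δ) * ∑ k ∈ Finset.range N, μ.real (A k)
      ≤ ∑ k ∈ Finset.range N, μ.real (A k ∩ B k) := by
    rw [Finset.mul_sum]
    exact Finset.sum_le_sum fun k _ => hX.mul_measureReal_activeSet_le hf hδ hquality ε k
  have hAB : ∑ k ∈ Finset.range N, μ.real (A k ∩ B k) ≤ ∑ k ∈ Finset.range N, μ.real (A' k ∩ B k)
      + (∑ k ∈ Finset.range N, μ.real (A k) - ∑ k ∈ Finset.range N, μ.real (A' k)) := by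
    rw [← Finset.sum_sub_distrib, ← Finset.sum_add_distrib]
    refine Finset.sum_le_sum fun k _ => ?_
    have hsub : A' k ⊆ A k := Set.inter_subset_left
    rw [← measureReal_sdiff hsub (hA' k)]
    refine (measureReal_mono ?_).trans (measureReal_union_le _ _)
    intro ω hω
    by_cases h : ω ∈ A' k
    · exact Or.inl ⟨h, hω.2⟩
    · exact Or.inr ⟨hω.1, h⟩
  -- Being active at k + 1 implies survival of k, so only the event at index 0 is left over.
  have hAA : ∑ k ∈ Finset.range N, μ.real (A k) ≤ ∑ k ∈ Finset.range N, μ.real (A' k) + 1 := by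
    cases N with
    | zero => simp
    | succ N =>
      rw [Finset.sum_range_succ', Finset.sum_range_succ (fun k => μ.real (A' k))]
      have h1 : ∑ k ∈ Finset.range N, μ.real (A (k + 1)) ≤ ∑ k ∈ Finset.range N, μ.real (A' k) :=
        Finset.sum_le_sum fun k _ => measureReal_mono (activeSet_succ_subset ε k)
      have h2 : μ.real (A 0) ≤ 1 := measureReal_le_one
      have h3 : 0 ≤ μ.real (A' N) := measureReal_nonneg
      linarith
  -- With S and S' the sums over active and survived events, (1 - δ)S ≤ ψ + aS' + S - S' and S ≤ S'
  -- + 1 give (1 - δ - a)S' ≤ ψ + δ.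
  rw [le_div_iff₀ (by linarith)]
  nlinarith

theorem IsRandomRun.lintegral_min_le [IsProbabilityMeasure μ]
    (hX : IsRandomRun μ ℱ f P X) {L : ℝ≥0} (hf : Smooth2Plus f L) {ε b : ℝ}
    (h : ∀ N, ∑ k ∈ Finset.range N, μ.real (survivalSet f P X ε k) ≤ b) :
    ∫⁻ ω, ((min ((X ω).hitting f ε) ((X ω).stopping P) : ℕ∞) : ℝ≥0∞) ∂μ ≤ ENNReal.ofReal b := by
  have hA' : ∀ k, MeasurableSet (survivalSet f P X ε k) := hX.measurableSet_survivalSet hf ε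
  refine (lintegral_mono fun ω => toENNReal_min_le_tsum ω ε).trans ?_
  rw [lintegral_tsum fun k => (measurable_one.indicator (hA' k)).aemeasurable]
  refine ENNReal.tsum_le_of_sum_range_le fun N => ?_
  simp_rw [lintegral_indicator_one (hA' _)]
  rw [← Finset.sum_congr rfl fun k _ => ofReal_measureReal (μ := μ) (s := survivalSet f P X ε k),
    ← ENNReal.ofReal_sum_of_nonneg fun k _ => measureReal_nonneg]
  exact ENNReal.ofReal_le_ofReal (h N)

end Probability

/-! ### The bound -/

namespace Params

variable {n p : ℕ} (P : Params n p)

theorem one_sub_C1_div : 1 - P.C1 / (P.C1 + 1) = 1 / (P.C1 + 1) := by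
  have := P.C1_pos
  field_simp
  ring

theorem C3_pos {δ : ℝ} (hδ' : δ < 1 / (P.C1 + 1)) : 0 < P.C3 δ := by
  have h1 := P.one_sub_C1_div
  have h2 : 0 ≤ P.C1 / (P.C1 + 1) := div_nonneg P.C1_pos.le (by linarith [P.C1_pos])
  unfold C3
  exact div_pos (pow_pos (by linarith) 2) (by linarith)

theorem half_le_exp_neg_add (y : ℝ) : 1 / 2 ≤ Real.exp (-y) + y / 2 := by
  have h1 := Real.add_one_le_exp (-y)
  have h2 := Real.exp_pos (-y)
  rcases le_total y 1 with h | h <;> linarith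

/-- With N = `Kmin` + 1, the claim is 1 + δ/u ≤ N/2 + e^(-cN)/(1 - e^(-c)). Replacing 1 - e^(-c) by
the larger c, the right side is at least 1/(2c) for every N, by `half_le_exp_neg_add` at cN. -/
theorem le_bound {L α gap κH c₁ δ ε : ℝ} (hδ : 0 < δ) (hδ' : δ < 1 / (P.C1 + 1)) :
    (P.psi L α gap κH c₁ ε + δ) / (1 - δ - P.C1 / (P.C1 + 1)) ≤ P.bound L α gap κH c₁ δ ε := by
  have hC3 := P.C3_pos hδ'
  have ha := P.one_sub_C1_div
  have ha0 : 0 ≤ P.C1 / (P.C1 + 1) := div_nonneg P.C1_pos.le (by linarith [P.C1_pos])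
  unfold bound Kmin
  set ψ := P.psi L α gap κH c₁ ε
  set c := P.C3 δ with hc
  unfold C3 at hc
  set u := 1 - δ - P.C1 / (P.C1 + 1) with hu
  have hu0 : 0 < u := by linarith
  have huq : u ≤ 1 - δ := by linarith
  set N := 2 * ψ / u with hN
  have hψ : ψ / u = N / 2 := by
    rw [hN]
    ring
  have h1 : 1 - Real.exp (-c) ≤ c := by linarith [Real.add_one_le_exp (-c)]
  have h2 : 0 < 1 - Real.exp (-c) := by
    rw [sub_pos, Real.exp_lt_one_iff]
    linarith
  have h3 : Real.exp (-c * N) / c ≤ Real.exp (-c * N) / (1 - Real.exp (-c)) := by gcongr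
  have h4 : 1 / 2 / c ≤ Real.exp (-c * N) / c + N / 2 := by
    have := half_le_exp_neg_add (c * N)
    rw [← neg_mul] at this
    calc 1 / 2 / c ≤ (Real.exp (-c * N) + c * N / 2) / c := by gcongr
      _ = _ := by field_simp
  -- By the choice of C₃, 1/(2c) = 4(1 - δ)/u², with room to spare because u(u + δ) ≤ u ≤ 1 - δ.
  have h5 : 1 + δ / u ≤ 1 / 2 / c := by
    rw [hc, div_div_eq_mul_div, le_div_iff₀ (pow_pos hu0 2)]
    calc (1 + δ / u) * u ^ 2 = u * (u + δ) := by field_simp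
      _ ≤ u * 1 := by
        gcongr
        linarith
      _ ≤ 1 / 2 * (8 * (1 - δ)) := by linarith
  rw [add_div, hψ, sub_add_cancel]
  linarith

theorem bound_isBigO {L : ℝ≥0} {α gap κH c₁ δ : ℝ} (hα : 0 < α) (hgap : 0 ≤ gap) (hκH : 1 ≤ κH)
    (hc₁ : 0 < c₁) (hδ' : δ < 1 / (P.C1 + 1)) :
    (fun ε : ℝ => P.bound L α gap κH c₁ δ ε) =O[𝓝[>] 0] (fun ε : ℝ => ε ^ (-2 : ℤ)) := by
  have hC3 := P.C3_pos hδ'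
  have ha := P.one_sub_C1_div
  have hMD := P.MD_pos
  have hκ := P.κlin_nonneg L
  have hmu := P.mu_pos
  have hη := P.η1_pos
  have hΔ := P.Δmin_pos
  set u := 1 - δ - P.C1 / (P.C1 + 1) with hu
  have hu0 : 0 < u := by linarith
  set b := α / ((P.κlin L * P.mu + 1) * P.MD) with hb
  have hb0 : 0 < b := by positivity
  have heg : ∀ ε, P.εg L α ε = b * ε := fun ε => by
    rw [εg, hb]
    ring
  set K := gap * κH / (P.η1 * c₁ * b ^ 2) with hK
  have hK0 : 0 ≤ K := by positivity
  set c₂ := P.C2 / (P.C1 + 1) with hc₂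
  have hc₂0 : 0 ≤ c₂ := div_nonneg P.C2_nonneg (by linarith [P.C1_pos])
  set e := 1 - Real.exp (-P.C3 δ) with he
  have he0 : 0 < e := by
    rw [he, sub_pos, Real.exp_lt_one_iff]
    linarith
  refine Asymptotics.IsBigO.of_bound (2 * (K + c₂) / u + 1 + 1 / e) ?_
  -- Below this threshold the minimum in φ is ε_g/κ_H, so φ is an exact multiple of ε⁻², and ε⁻² ≥ 1
  -- absorbs the constant terms.
  have hev : Set.Ioo 0 (min 1 (P.Δmin * κH / b)) ∈ 𝓝[>] (0 : ℝ) :=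
    Ioo_mem_nhdsGT (lt_min one_pos (by positivity))
  filter_upwards [hev] with ε hε
  have hε0 : 0 < ε := hε.1
  have hε1 : ε < 1 := hε.2.trans_le (min_le_left _ _)
  have hε2 : b * ε / κH ≤ P.Δmin := by
    have := hε.2.trans_le (min_le_right _ _)
    rw [lt_div_iff₀ hb0] at this
    rw [div_le_iff₀ (by linarith)]
    linarith
  set z := ε ^ (-2 : ℤ) with hz
  have hz1 : 1 ≤ z := by
    rw [hz, zpow_neg]
    refine (one_le_inv₀ (by positivity)).2 ?_
    exact_mod_cast pow_le_one₀ (n := 2) hε0.le hε1.le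
  have hphi : P.phi L α gap κH c₁ ε = K * z := by
    rw [phi, heg, min_eq_left hε2, hK, hz, zpow_neg]
    norm_cast
    field_simp
  have hpsi : P.psi L α gap κH c₁ ε = K * z + c₂ := by rw [psi, hphi]
  have hN0 : 0 ≤ 2 * (K * z + c₂) / u := by positivity
  have hN1 : 2 * (K * z + c₂) / u ≤ 2 * (K + c₂) / u * z := by
    calc 2 * (K * z + c₂) / u ≤ 2 * ((K + c₂) * z) / u := by
          gcongr
          nlinarith
      _ = _ := by ring
  have hexp : Real.exp (-P.C3 δ * (2 * (K * z + c₂) / u)) / e ≤ 1 / e * z := by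
    have : Real.exp (-P.C3 δ * (2 * (K * z + c₂) / u)) ≤ 1 := by
      rw [Real.exp_le_one_iff, neg_mul]
      exact neg_nonpos.2 (by positivity)
    calc _ ≤ 1 / e := div_le_div_of_nonneg_right this he0.le
      _ ≤ 1 / e * z := le_mul_of_one_le_right (by positivity) hz1
  have hexp0 : 0 ≤ Real.exp (-P.C3 δ * (2 * (K * z + c₂) / u)) / e := by positivity
  rw [bound, Kmin, hpsi, sub_add_cancel, Real.norm_eq_abs, Real.norm_of_nonneg (by linarith)]
  rw [abs_le]
  constructor <;> nlinarith

end Params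

end QARSTA

theorem mainTheorem3 {n p : ℕ} {Ω : Type*} [mΩ : MeasurableSpace Ω] (μ : Measure Ω)
    [IsProbabilityMeasure μ] (ℱ : Filtration ℕ mΩ)
    (f : QARSTA.E n → ℝ) (P : QARSTA.Params n p) (X : Ω → QARSTA.Trace n p)
    (hX : QARSTA.IsRandomRun μ ℱ f P X)
    (L : ℝ≥0) (hsmooth : QARSTA.Smooth2Plus f L)
    (flow : ℝ) (hbelow : ∀ x, flow ≤ f x)
    (κH : ℝ) (hκH : 1 ≤ κH) (hHess : QARSTA.ModelHessBound μ f P X κH)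
    (c₁ : ℝ) (hc₁_pos : 0 < c₁) (hc₁_le : c₁ ≤ 1 / 2) (hCauchy : QARSTA.CauchyDecrease μ f P X c₁)
    (αD : ℝ) (hαD : 0 < αD) (δS : ℝ) (hδS_pos : 0 < δS) (hδS_lt : δS < 1 / (P.C1 + 1))
    (hquality : QARSTA.SubspaceQuality μ ℱ f P X αD δS) :
    (∀ ε : ℝ, 0 < ε →
      (∫⁻ ω, ((min ((X ω).hitting f ε) ((X ω).stopping P) : ℕ∞) : ℝ≥0∞) ∂μ
        ≤ ENNReal.ofReal (P.bound L αD (f P.x0 - flow) κH c₁ δS ε)) ∧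
      ((∀ᵐ ω ∂μ, (X ω).hitting f ε ≤ (X ω).stopping P) →
        ∫⁻ ω, (((X ω).hitting f ε : ℕ∞) : ℝ≥0∞) ∂μ
          ≤ ENNReal.ofReal (P.bound L αD (f P.x0 - flow) κH c₁ δS ε))) ∧
    (fun ε : ℝ => P.bound L αD (f P.x0 - flow) κH c₁ δS ε)
      =O[𝓝[>] 0] (fun ε : ℝ => ε ^ (-2 : ℤ)) := by
  have hgap : 0 ≤ f P.x0 - flow := sub_nonneg.2 (hbelow _)
  have hmain : ∀ ε : ℝ, 0 < ε →
      ∫⁻ ω, ((min ((X ω).hitting f ε) ((X ω).stopping P) : ℕ∞) : ℝ≥0∞) ∂μ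
        ≤ ENNReal.ofReal (P.bound L αD (f P.x0 - flow) κH c₁ δS ε) := fun ε hε =>
    hX.lintegral_min_le hsmooth fun N =>
      (hX.sum_measureReal_survivalSet_le hsmooth hbelow hκH hHess hc₁_pos hCauchy hαD hδS_pos
        hδS_lt hquality hε N).trans (P.le_bound hδS_pos hδS_lt)
  refine ⟨fun ε hε => ⟨hmain ε hε, fun hle => ?_⟩,
    P.bound_isBigO hαD hgap hκH hc₁_pos hδS_lt⟩
  refine le_trans (le_of_eq (lintegral_congr_ae ?_)) (hmain ε hε)
  filter_upwards [hle] with ω hω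
  rw [min_eq_left hω]
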